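/- For integers $n\ge 0$ and $k_1,\dots,k_n\ge 1$ (with $k_n\ge 2$ if $n\ge 1$) let $$\zeta(k_1,\dots,k_n)=\sum_{0<m_1<\cdots<m_n}\frac{1}{m_1^{k_1}\cdots m_n^{k_n}},$$ so that the value for $n=0$ is $1$, and let $\{2\}^n$ denote the string of $n$ twos. For integers $a,b\ge 0$ put $$H(a,b)=\zeta(\{2\}^a,3,\{2\}^b),\qquad \widehat H(a,b)=2\sum_{r=1}^{a+b+1}(-1)^r c_{a,b}^r\,\zeta(2r+1)\,\zeta(\{2\}^{a+b+1-r}),$$ where $$c_{a,b}^r=\binom{2r}{2a+2}-\bigl(1-2^{-2r}\bigr)\binom{2r}{2b+1}.$$ For $x,y\in\mathbb C$ put $$F(x,y)=\sum_{a,b\ge0}(-1)^{a+b+1}H(a,b)\,x^{2a+2}y^{2b+1},\qquad \widehat F(x,y)=\sum_{a,b\ge0}(-1)^{a+b+1}\widehat H(a,b)\,x^{2a+2}y^{2b+1}.$$ Write $(\alpha)_n=\alpha(\alpha+1)\cdots(\alpha+n-1)$, $(\alpha)_0=1$, $${}_3F_2\left({\alpha_1,\alpha_2,\alpha_3\atop\beta_1,\beta_2};z\right)=\sum_{n=0}^\infty\frac{(\alpha_1)_n(\alpha_2)_n(\alpha_3)_n}{n!\,(\beta_1)_n(\beta_2)_n}z^n,$$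 and $\psi=\Gamma'/\Gamma$. Then the following hold. (1) The multiple zeta series $\zeta(\{2\}^n)$ $(n\ge 0)$, $\zeta(2r+1)$ $(r\ge1)$ and $\zeta(\{2\}^a,3,\{2\}^b)$ $(a,b\ge 0)$ converge, and for all integers $a,b\ge 0$ $$\zeta(\{2\}^a,3,\{2\}^b)=2\sum_{r=1}^{a+b+1}(-1)^r c_{a,b}^r\,\zeta(2r+1)\,\zeta(\{2\}^{a+b+1-r}).$$ (2) For all $x,y\in\mathbb C$ such that $y\notin\mathbb Z$ and neither $x+y$ nor $x-y$ is a nonzero integer, the series ${}_3F_2\left({x,-x,z\atop 1+y,1-y};1\right)$ converges absolutely for all $z$ in a neighbourhood of $0$, its sum is complex differentiable in $z$ at $z=0$, and $$\begin{aligned} \left.\frac{d}{dz}\right|_{z=0}{}_3F_2\left({x,-x,z\atop 1+y,1-y};1\right) ={}&\psi(1+y)+\psi(1-y)\\ &-\tfrac12\bigl[\psi(1+x+y)+\psi(1-x-y)+\psi(1+x-y)+\psi(1-x+y)\bigr]\\ &-\frac{\sin\pi x}{2\sin\pi y}\Bigl[\psi\bigl(1+\tfrac{x+y}2\bigr)+\psi\bigl(1-\tfrac{x+y}2\bigr)-\psi\bigl(1+\tfrac{x-y}2\bigr)-\psi\bigl(1-\tfrac{x-y}2\bigr)\\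 &\qquad\qquad-\psi(1+x+y)-\psi(1-x-y)+\psi(1+x-y)+\psi(1-x+y)\Bigr]. \end{aligned}$$ (3) For all $x,y\in\mathbb C$ the double series defining $F(x,y)$ and $\widehat F(x,y)$ converge absolutely, and $F(x,y)=\widehat F(x,y)$. -/

import Mathlib

open Filter Topology

noncomputable section

/-- The index set of a multiple zeta value of depth `n`:
tuples of integers `0 < m 0 < m 1 < ⋯ < m (n - 1)`. -/
def MZVIndex (n : ℕ) : Type :=
  {m : Fin n → ℕ // (∀ i, 0 < m i) ∧ StrictMono m}

/-- The summand `1 / (m₁ ^ k₁ ⋯ mₙ ^ kₙ)` of the series `ζ(k₁, …, kₙ)`. -/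
def mzvTerm {n : ℕ} (k : Fin n → ℕ) (m : MZVIndex n) : ℝ :=
  1 / ∏ i, (m.1 i : ℝ) ^ k i

/-- The multiple zeta value `ζ(k₁, …, kₙ)`, the sum over `0 < m₁ < ⋯ < mₙ`.
For `n = 0` it is `1`. -/
def mzv {n : ℕ} (k : Fin n → ℕ) : ℝ :=
  ∑' m : MZVIndex n, mzvTerm k m

/-- The argument string `(2, …, 2)` of length `n`. -/
def twos (n : ℕ) : Fin n → ℕ := fun _ => 2

/-- The argument string `(2, …, 2, 3, 2, …, 2)`, with `a` twos before the `3` and `b` after. -/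
def twosThreeTwos (a b : ℕ) : Fin (a + 1 + b) → ℕ :=
  fun i => if (i : ℕ) = a then 3 else 2

/-- The argument string `(k)` of length one. -/
def single (k : ℕ) : Fin 1 → ℕ := fun _ => k

/-- `c_{a,b}^r = C(2r, 2a+2) - (1 - 2^{-2r}) C(2r, 2b+1)`. -/
def zagierCoeff (a b r : ℕ) : ℝ :=
  ((2 * r).choose (2 * a + 2) : ℝ) - (1 - 1 / 2 ^ (2 * r)) * ((2 * r).choose (2 * b + 1) : ℝ)

/-- `H(a,b) = ζ(2, …, 2, 3, 2, …, 2)`. -/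
def zagierH (a b : ℕ) : ℝ := mzv (twosThreeTwos a b)

/-- `Ĥ(a,b)`, the right-hand side of the evaluation formula. -/
def zagierHhat (a b : ℕ) : ℝ :=
  2 * ∑ r ∈ Finset.Icc 1 (a + b + 1),
    (-1) ^ r * zagierCoeff a b r * mzv (single (2 * r + 1)) * mzv (twos (a + b + 1 - r))

/-- The term with index `(a, b)` of the generating series
`∑ (-1)^(a+b+1) h(a,b) x^(2a+2) y^(2b+1)` of a double sequence `h`. -/
def genTerm (h : ℕ → ℕ → ℝ) (x y : ℂ) (p : ℕ × ℕ) : ℂ :=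
  (-1) ^ (p.1 + p.2 + 1) * (h p.1 p.2 : ℂ) * x ^ (2 * p.1 + 2) * y ^ (2 * p.2 + 1)

/-- The generating function `F(x,y)` of the `H(a,b)`. -/
def zagierF (x y : ℂ) : ℂ := ∑' p : ℕ × ℕ, genTerm zagierH x y p

/-- The generating function `F̂(x,y)` of the `Ĥ(a,b)`. -/
def zagierFhat (x y : ℂ) : ℂ := ∑' p : ℕ × ℕ, genTerm zagierHhat x y p

/-- The ascending Pochhammer symbol `(α)ₙ = α (α + 1) ⋯ (α + n - 1)`. -/
def poch (α : ℂ) (n : ℕ) : ℂ := ∏ j ∈ Finset.range n, (α + j)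

/-- The `n`-th term of the generalized hypergeometric series `₃F₂(α₁, α₂, α₃; β₁, β₂; z)`. -/
def hyp32Term (α₁ α₂ α₃ β₁ β₂ z : ℂ) (n : ℕ) : ℂ :=
  poch α₁ n * poch α₂ n * poch α₃ n / (n.factorial * poch β₁ n * poch β₂ n) * z ^ n

/-- The generalized hypergeometric series `₃F₂(α₁, α₂, α₃; β₁, β₂; z)`. -/
def hyp32 (α₁ α₂ α₃ β₁ β₂ z : ℂ) : ℂ := ∑' n : ℕ, hyp32Term α₁ α₂ α₃ β₁ β₂ z n

/-- Zagier's explicit expression in digamma values and sines; `Complex.digamma` is `Γ' / Γ`. -/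
def zagierPsi (x y : ℂ) : ℂ :=
  Complex.digamma (1 + y) + Complex.digamma (1 - y)
    - 1 / 2 * (Complex.digamma (1 + x + y) + Complex.digamma (1 - x - y)
        + Complex.digamma (1 + x - y) + Complex.digamma (1 - x + y))
    - Complex.sin (Real.pi * x) / (2 * Complex.sin (Real.pi * y))
      * (Complex.digamma (1 + (x + y) / 2) + Complex.digamma (1 - (x + y) / 2)
        - Complex.digamma (1 + (x - y) / 2) - Complex.digamma (1 - (x - y) / 2)
        - Complex.digamma (1 + x + y) - Complex.digamma (1 - x - y)
        + Complex.digamma (1 + x - y) + Complex.digamma (1 - x + y))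

end

/-!
The three assertions come from one object, the series `S(x, y) = ∑ (x)ₙ (-x)ₙ / (n (1+y)ₙ (1-y)ₙ)`
over `n ≥ 1`, which is evaluated in two ways.

*As generating function and as derivative.* In `∑ 1 / (m₁² ⋯ mₐ² n³ m'₁² ⋯ m'_b²)`, summed over all
`a` and `b` with alternating signs and powers of `x` and `y`, the entries below and above `n` are
arbitrary finite sets of integers in `(0, n)` and `(n, ∞)`. The sums over these sets are a partial
product and a tail of Euler's product for the sine, so that `F(x, y) = (sin π y / π) S(x, y)`
(`hasSum_zagierF_of_notInt`). Everything converges absolutely because `∑ ∏_{j ∈ S} |x² / j²|` over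
finite sets `S` does. On the other hand `(z)ₙ` has derivative `(n - 1)!` at `z = 0`, so `S(x, y)` is
the derivative of `₃F₂(x, -x, z; 1 + y, 1 - y; 1)` there (`hasDerivAt_hyp32`).

*As an integral.* From `cos 2xφ = ∑ (x)ₙ (-x)ₙ / (n! (1/2)ₙ) sin²ⁿ φ` (`hasSum_cosCoeff`) and the
moments `∫ sin²ⁿ φ cos (y (π - 2φ)) dφ` on `[0, π/2]` (`momentInt_eq`) one gets
`(sin π y / 2) S(x, y) = ∫₀^{π/2} (cos 2xφ - 1) cot φ sin (y (π - 2φ)) dφ`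
(`hasSum_integral_cotIntegrand`). Replacing `cot φ` by the partial sums of `2 ∑ sin 2kφ`, with an
error that vanishes by the Riemann–Lebesgue lemma, turns the integral into a series of simple
fractions with poles at `x + y`, `x - y`, `y ∈ ℤ` (`tendsto_sum_fracTerm`).

That series gives the rest. Since `ψ(s) = lim (log n - ∑_{j < n} 1 / (s + j))`, which follows by
differentiating Euler's limit for `Γ`, it sums to digamma values (`tsum_derivTerm_eq_zagierPsi`).
Expanded in powers of `x` and `y` near the origin, it has the zeta values `ζ(2r + 1)` as
coefficients; multiplied by the expansions of `sin π x` and `sin π y`, whose coefficients are the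
`ζ({2}ⁿ)` (`hasSum_mzv_twos`), it becomes `F̂` (`hasSum_genTerm_zagierHhat`). Comparing coefficients
of `F` and `F̂` near the origin gives `H(a, b) = Ĥ(a, b)` (`zagierH_eq_zagierHhat`), hence `F = F̂`
everywhere.
-/

/-! ### Generating series over finite sets of positive integers -/

/-- The partial product `∏_{1 ≤ j ≤ n} (1 - z² / j²)` of Euler's product for `sin (π z) / (π z)`. -/
noncomputable def eulerProd (n : ℕ) (z : ℂ) : ℂ :=
  ∏ j ∈ Finset.range n, (1 - z ^ 2 / ((j : ℂ) + 1) ^ 2)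

/-- The weight `-x² / j²` of the integers `0 < j < n`, extended by zero; at `j = 0` it is zero
because division by zero gives zero. -/
noncomputable def lowerWeight (x : ℂ) (n j : ℕ) : ℂ :=
  if j < n then -x ^ 2 / (j : ℂ) ^ 2 else 0

/-- The weight `-y² / j²` of the integers `j > n`, extended by zero. -/
noncomputable def upperWeight (y : ℂ) (n j : ℕ) : ℂ :=
  if n < j then -y ^ 2 / (j : ℂ) ^ 2 else 0

lemma summable_norm_sq_div_sq (x : ℂ) : Summable fun j : ℕ => ‖-x ^ 2 / (j : ℂ) ^ 2‖ := by
  have h : Summable fun j : ℕ => 1 / (j : ℝ) ^ 2 := Real.summable_one_div_nat_pow.2 one_lt_two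
  refine (h.mul_left (‖x‖ ^ 2)).congr fun j => ?_
  simp [div_eq_mul_inv]

lemma norm_lowerWeight_le (x : ℂ) (n j : ℕ) : ‖lowerWeight x n j‖ ≤ ‖-x ^ 2 / (j : ℂ) ^ 2‖ := by
  unfold lowerWeight
  split_ifs
  · exact le_rfl
  · rw [norm_zero]
    exact norm_nonneg _

lemma norm_upperWeight_le (y : ℂ) (n j : ℕ) : ‖upperWeight y n j‖ ≤ ‖-y ^ 2 / (j : ℂ) ^ 2‖ := by
  unfold upperWeight
  split_ifs
  · exact le_rfl
  · rw [norm_zero]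
    exact norm_nonneg _

lemma summable_norm_prod_sq_div_sq (x : ℂ) :
    Summable fun S : Finset ℕ => ∏ j ∈ S, ‖-x ^ 2 / (j : ℂ) ^ 2‖ :=
  summable_finsetProd_of_summable_norm (R := ℝ) (by simpa using summable_norm_sq_div_sq x)

lemma summable_norm_prod_lowerWeight (x : ℂ) (n : ℕ) :
    Summable fun S : Finset ℕ => ‖∏ j ∈ S, lowerWeight x n j‖ :=
  (summable_norm_prod_sq_div_sq x).of_nonneg_of_le (fun _ => norm_nonneg _) fun S => by
    rw [norm_prod]
    exact Finset.prod_le_prod (fun _ _ => norm_nonneg _) fun j _ => norm_lowerWeight_le x n j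

lemma summable_norm_prod_upperWeight (y : ℂ) (n : ℕ) :
    Summable fun S : Finset ℕ => ‖∏ j ∈ S, upperWeight y n j‖ :=
  (summable_norm_prod_sq_div_sq y).of_nonneg_of_le (fun _ => norm_nonneg _) fun S => by
    rw [norm_prod]
    exact Finset.prod_le_prod (fun _ _ => norm_nonneg _) fun j _ => norm_upperWeight_le y n j

/-- The sum over the finite sets of integers in `(0, n]` is a partial product of Euler's product for
the sine. -/
lemma tsum_prod_lowerWeight (x : ℂ) (n : ℕ) :
    ∑' S : Finset ℕ, ∏ j ∈ S, lowerWeight x (n + 1) j = eulerProd n x := by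
  rw [← tprod_one_add (summable_norm_prod_lowerWeight x (n + 1)).of_norm,
    tprod_eq_prod (s := Finset.range (n + 1)), Finset.prod_range_succ', eulerProd]
  · have h0 : lowerWeight x (n + 1) 0 = 0 := by simp [lowerWeight]
    rw [h0, add_zero, mul_one]
    refine Finset.prod_congr rfl fun j hj => ?_
    rw [Finset.mem_range] at hj
    rw [lowerWeight, if_pos (by lia)]
    push_cast
    ring
  · intro j hj
    rw [Finset.mem_range] at hj
    rw [lowerWeight, if_neg hj, add_zero]

/-- The sum over finite sets of integers `> n` is the tail of Euler's product for the sine. -/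
lemma tsum_prod_upperWeight (y : ℂ) (n : ℕ) :
    Real.pi * y * (eulerProd n y * ∑' S : Finset ℕ, ∏ j ∈ S, upperWeight y n j)
      = Complex.sin (Real.pi * y) := by
  have h1 := hasProd_one_add_of_hasSum_prod (summable_norm_prod_upperWeight y n).of_norm.hasSum
  have h2 := ((h1.tendsto_prod_nat.comp (tendsto_add_atTop_nat (n + 1))).const_mul
    (eulerProd n y)).const_mul (Real.pi * y)
  refine tendsto_nhds_unique h2 ?_
  refine ((Complex.tendsto_euler_sin_prod y).comp (tendsto_add_atTop_nat n)).congr fun k => ?_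
  simp only [Function.comp_apply]
  congr 1
  induction k with
  | zero =>
    rw [Finset.prod_eq_one (s := Finset.range (0 + (n + 1))), mul_one, zero_add, eulerProd]
    intro j hj
    rw [Finset.mem_range] at hj
    simp [upperWeight, if_neg (show ¬ n < j by lia)]
  | succ k ih =>
    rw [show k + 1 + n = (k + n) + 1 by ring, Finset.prod_range_succ, ih,
      show k + 1 + (n + 1) = (k + (n + 1)) + 1 by ring, Finset.prod_range_succ, mul_assoc]
    congr 2
    rw [upperWeight, if_pos (by lia)]
    push_cast
    ring

/-! ### Multiple zeta values as sums over finite sets -/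

/-- Strictly increasing enumerations are determined by their set of values. -/
lemma strictMono_eq_of_image_eq {n : ℕ} {f g : Fin n → ℕ} (hf : StrictMono f) (hg : StrictMono g)
    (h : Finset.univ.image f = Finset.univ.image g) : f = g := by
  rw [← hf.range_inj hg]
  simpa using congrArg (fun s : Finset ℕ => (s : Set ℕ)) h

/-- The index set of all `ζ({2}^n)` embedded into the finite sets of integers. -/
def indexSet (p : Σ n, MZVIndex n) : Finset ℕ := Finset.univ.image p.2.1

lemma indexSet_injective : Function.Injective indexSet := by
  rintro ⟨n, m⟩ ⟨n', m'⟩ h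
  have hc : n = n' := by
    have := congrArg Finset.card h
    simpa [indexSet, Finset.card_image_of_injective _ m.2.2.injective,
      Finset.card_image_of_injective _ m'.2.2.injective] using this
  subst hc
  rw [Subtype.ext (strictMono_eq_of_image_eq m.2.2 m'.2.2 h)]

lemma mem_range_indexSet {S : Finset ℕ} (h : 0 ∉ S) : S ∈ Set.range indexSet := by
  refine ⟨⟨S.card, S.orderEmbOfFin rfl, fun i => ?_, (S.orderEmbOfFin rfl).strictMono⟩, ?_⟩
  · exact Nat.pos_of_ne_zero fun h0 => h (h0 ▸ S.orderEmbOfFin_mem rfl i)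
  · simp only [indexSet]
    exact Finset.image_orderEmbOfFin_univ S rfl

/-- With the threshold `0`, `upperWeight` weighs all positive integers. -/
lemma prod_indexSet_upperWeight (y : ℂ) (p : Σ n, MZVIndex n) :
    ∏ j ∈ indexSet p, upperWeight y 0 j = (-1) ^ p.1 * y ^ (2 * p.1) * mzvTerm (twos p.1) p.2 := by
  obtain ⟨n, m⟩ := p
  rw [indexSet, Finset.prod_image fun _ _ _ _ h => m.2.2.injective h]
  simp only [upperWeight, if_pos (m.2.1 _), mzvTerm, twos]
  push_cast
  rw [Finset.prod_div_distrib]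
  simp [neg_pow (y ^ 2), pow_mul, div_eq_mul_inv]

lemma summable_prod_indexSet (y : ℂ) :
    Summable fun p => ∏ j ∈ indexSet p, upperWeight y 0 j :=
  (summable_norm_prod_upperWeight y 0).of_norm.comp_injective indexSet_injective

lemma summable_mzvTerm_twos (n : ℕ) : Summable (mzvTerm (twos n)) := by
  have h := (summable_prod_indexSet 1).sigma_factor n
  simp only [prod_indexSet_upperWeight] at h
  rw [summable_mul_left_iff (by simp)] at h
  exact Complex.summable_ofReal.1 h

/-- Generating series of the `ζ({2}^n)`. -/
lemma hasSum_mzv_twos (y : ℂ) :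
    HasSum (fun n : ℕ => (-1) ^ n * (mzv (twos n) : ℂ) * (Real.pi * y ^ (2 * n + 1)))
      (Complex.sin (Real.pi * y)) := by
  have h1 : HasSum (fun p => ∏ j ∈ indexSet p, upperWeight y 0 j)
      (∑' S : Finset ℕ, ∏ j ∈ S, upperWeight y 0 j) := by
    refine (indexSet_injective.hasSum_iff (f := fun S : Finset ℕ => ∏ j ∈ S, upperWeight y 0 j)
      fun S hS => ?_).2 (summable_norm_prod_upperWeight y 0).of_norm.hasSum
    have h0 : 0 ∈ S := by
      by_contra h
      exact hS (mem_range_indexSet h)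
    exact Finset.prod_eq_zero h0 (by simp [upperWeight])
  have h2 := h1.sigma (g := fun n => (-1) ^ n * y ^ (2 * n) * (mzv (twos n) : ℂ)) fun n => by
    simp only [prod_indexSet_upperWeight]
    exact (Complex.hasSum_ofReal.2 (summable_mzvTerm_twos n).hasSum).mul_left _
  have h3 := h2.mul_left (Real.pi * y)
  have h4 := tsum_prod_upperWeight y 0
  rw [eulerProd, Finset.prod_range_zero, one_mul] at h4
  rw [h4] at h3
  refine h3.congr_fun fun n => ?_
  ring

/-- The index of a term of `ζ({2}^a, 3, {2}^b)`, cut at the entry with exponent `3`: that entry,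
the set of the entries before it, the set of the entries after it. -/
def splitIndex (p : Σ q : ℕ × ℕ, MZVIndex (q.1 + 1 + q.2)) : ℕ × Finset ℕ × Finset ℕ :=
  (p.2.1 (Fin.castAdd p.1.2 (Fin.last p.1.1)),
    Finset.univ.image (fun i : Fin p.1.1 => p.2.1 (Fin.castAdd p.1.2 (Fin.castSucc i))),
    Finset.univ.image (fun i : Fin p.1.2 => p.2.1 (Fin.natAdd (p.1.1 + 1) i)))

lemma splitIndex_injective : Function.Injective splitIndex := by
  rintro ⟨⟨a, b⟩, m, hm0, hm⟩ ⟨⟨a', b'⟩, m', hm0', hm'⟩ h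
  simp only [splitIndex, Prod.mk.injEq] at h
  obtain ⟨h1, h2, h3⟩ := h
  have hS : ∀ {a b : ℕ} {m : Fin (a + 1 + b) → ℕ}, StrictMono m →
      StrictMono (fun i : Fin a => m (Fin.castAdd b (Fin.castSucc i))) :=
    fun hm i j hij => hm hij
  have hT : ∀ {a b : ℕ} {m : Fin (a + 1 + b) → ℕ}, StrictMono m →
      StrictMono (fun i : Fin b => m (Fin.natAdd (a + 1) i)) :=
    fun hm i j hij => hm (by simpa using hij)
  have ha : a = a' := by
    have := congrArg Finset.card h2
    simpa [Finset.card_image_of_injective _ (hS hm).injective,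
      Finset.card_image_of_injective _ (hS hm').injective] using this
  have hb : b = b' := by
    have := congrArg Finset.card h3
    simpa [Finset.card_image_of_injective _ (hT hm).injective,
      Finset.card_image_of_injective _ (hT hm').injective] using this
  subst ha hb
  have e2 := strictMono_eq_of_image_eq (hS hm) (hS hm') h2
  have e3 := strictMono_eq_of_image_eq (hT hm) (hT hm') h3
  have : m = m' := by
    funext i
    refine Fin.addCases (fun i => ?_) (fun i => congrFun e3 i) i
    exact Fin.lastCases h1 (fun i => congrFun e2 i) i
  subst this
  rfl

/-- Every cut with entries in the right places comes from an index: concatenate the increasing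
enumeration of `S`, the entry `n` and the increasing enumeration of `T`. -/
lemma mem_range_splitIndex {n : ℕ} {S T : Finset ℕ} (hn : 0 < n) (hS : ∀ j ∈ S, 0 < j ∧ j < n)
    (hT : ∀ j ∈ T, n < j) : (n, S, T) ∈ Set.range splitIndex := by
  let u : Fin (S.card + 1 + T.card) → ℕ :=
    Fin.append (Fin.snoc (α := fun _ => ℕ) (S.orderEmbOfFin rfl) n) (T.orderEmbOfFin rfl)
  have u1 : ∀ i, u (Fin.castAdd _ (Fin.castSucc i)) = S.orderEmbOfFin rfl i := by simp [u]
  have u2 : u (Fin.castAdd _ (Fin.last _)) = n := by simp [u]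
  have u3 : ∀ i, u (Fin.natAdd _ i) = T.orderEmbOfFin rfl i := by simp [u]
  have hS' := fun i => hS _ (S.orderEmbOfFin_mem rfl i)
  have hT' := fun i => hT _ (T.orderEmbOfFin_mem rfl i)
  have hpos : ∀ i, 0 < u i := by
    intro i
    induction i using Fin.addCases with
    | left i =>
      induction i using Fin.lastCases with
      | last => rwa [u2]
      | cast i => rw [u1]; exact (hS' i).1
    | right i => rw [u3]; exact hn.trans (hT' i)
  have hmono : StrictMono u := by
    intro i j h
    induction i using Fin.addCases with
    | left i =>
      induction j using Fin.addCases with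
      | left j =>
        induction i using Fin.lastCases with
        | last => exact absurd (Fin.le_last j) (not_le.2 h)
        | cast i =>
          induction j using Fin.lastCases with
          | last => rw [u1, u2]; exact (hS' i).2
          | cast j => rw [u1, u1]; exact (S.orderEmbOfFin rfl).strictMono h
      | right j =>
        rw [u3]
        induction i using Fin.lastCases with
        | last => rw [u2]; exact hT' j
        | cast i => rw [u1]; exact (hS' i).2.trans (hT' j)
    | right i =>
      induction j using Fin.addCases with
      | left j =>
        simp only [Fin.lt_def, Fin.val_castAdd, Fin.val_natAdd] at h
        lia
      | right j => rw [u3, u3]; exact (T.orderEmbOfFin rfl).strictMono (by simpa using h)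
  refine ⟨⟨(S.card, T.card), u, hpos, hmono⟩, ?_⟩
  simp only [splitIndex, u1, u2, u3]
  rw [Finset.image_orderEmbOfFin_univ S rfl, Finset.image_orderEmbOfFin_univ T rfl]

/-- The contribution of the index with cut `(n, S, T)` to the generating function `F(x, y)`; it
vanishes unless `S ⊆ (0, n)` and `T ⊆ (n, ∞)`. -/
noncomputable def splitTerm (x y : ℂ) (q : ℕ × Finset ℕ × Finset ℕ) : ℂ :=
  -(x ^ 2 * y) / (q.1 : ℂ) ^ 3
    * ((∏ j ∈ q.2.1, lowerWeight x q.1 j) * ∏ j ∈ q.2.2, upperWeight y q.1 j)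

lemma summable_splitTerm (x y : ℂ) : Summable (splitTerm x y) := by
  have h3 : Summable fun n : ℕ => ‖-(x ^ 2 * y) / (n : ℂ) ^ 3‖ := by
    have h : Summable fun j : ℕ => 1 / (j : ℝ) ^ 3 := Real.summable_one_div_nat_pow.2 (by norm_num)
    refine (h.mul_left ‖x ^ 2 * y‖).congr fun j => ?_
    simp [div_eq_mul_inv]
  have hST := (summable_norm_prod_sq_div_sq x).mul_of_nonneg (summable_norm_prod_sq_div_sq y)
    (fun _ => Finset.prod_nonneg fun _ _ => norm_nonneg _)
    (fun _ => Finset.prod_nonneg fun _ _ => norm_nonneg _)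
  refine (h3.mul_of_nonneg hST (fun _ => norm_nonneg _) fun _ => mul_nonneg
    (Finset.prod_nonneg fun _ _ => norm_nonneg _)
    (Finset.prod_nonneg fun _ _ => norm_nonneg _)).of_norm_bounded fun q => ?_
  rw [splitTerm, norm_mul, norm_mul, norm_prod, norm_prod]
  gcongr
  · exact norm_lowerWeight_le _ _ _
  · exact norm_upperWeight_le _ _ _

lemma splitTerm_splitIndex (x y : ℂ) (p : Σ q : ℕ × ℕ, MZVIndex (q.1 + 1 + q.2)) :
    splitTerm x y (splitIndex p) = (-1) ^ (p.1.1 + p.1.2 + 1) * x ^ (2 * p.1.1 + 2)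
      * y ^ (2 * p.1.2 + 1) * mzvTerm (twosThreeTwos p.1.1 p.1.2) p.2 := by
  obtain ⟨⟨a, b⟩, m, hm0, hm⟩ := p
  simp only [splitTerm, splitIndex, mzvTerm]
  rw [Finset.prod_image, Finset.prod_image, Fin.prod_univ_add, Fin.prod_univ_castSucc]
  · have hl : ∀ i : Fin a, m (Fin.castAdd b (Fin.castSucc i)) < m (Fin.castAdd b (Fin.last a)) :=
      fun i => hm (by simp [Fin.lt_def])
    have hu : ∀ i : Fin b, m (Fin.castAdd b (Fin.last a)) < m (Fin.natAdd (a + 1) i) :=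
      fun i => hm (by simp only [Fin.lt_def, Fin.val_castAdd, Fin.val_natAdd, Fin.val_last]; lia)
    have e1 : ∀ i : Fin a, twosThreeTwos a b (Fin.castAdd b (Fin.castSucc i)) = 2 := fun i => by
      simp [twosThreeTwos, i.2.ne]
    have e2 : twosThreeTwos a b (Fin.castAdd b (Fin.last a)) = 3 := by simp [twosThreeTwos]
    have e3 : ∀ i : Fin b, twosThreeTwos a b (Fin.natAdd (a + 1) i) = 2 := fun i => by
      simp only [twosThreeTwos, Fin.val_natAdd]
      rw [if_neg (by lia)]
    simp only [lowerWeight, upperWeight, if_pos (hl _), if_pos (hu _), e1, e2, e3]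
    push_cast
    rw [Finset.prod_div_distrib, Finset.prod_div_distrib]
    simp only [Finset.prod_const, Finset.card_univ, Fintype.card_fin, neg_pow (x ^ 2),
      neg_pow (y ^ 2), ← pow_mul]
    simp only [div_eq_mul_inv, mul_inv]
    ring
  · intro i _ j _ h
    simpa using hm.injective h
  · intro i _ j _ h
    simpa using hm.injective h

lemma summable_splitTerm_splitIndex (x y : ℂ) :
    Summable fun p => splitTerm x y (splitIndex p) :=
  (summable_splitTerm x y).comp_injective splitIndex_injective

lemma summable_mzvTerm_twosThreeTwos (a b : ℕ) : Summable (mzvTerm (twosThreeTwos a b)) := by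
  have h := (summable_splitTerm_splitIndex 1 1).sigma_factor (a, b)
  simp only [splitTerm_splitIndex] at h
  rw [summable_mul_left_iff (by simp)] at h
  exact Complex.summable_ofReal.1 h

/-- The double series `F(x, y)` converges absolutely for all `x` and `y`, and equals the sum of all
`splitTerm`s: those that do not come from an index vanish. -/
lemma hasSum_genTerm_zagierH (x y : ℂ) :
    HasSum (genTerm zagierH x y) (∑' q, splitTerm x y q) := by
  have h1 : HasSum (fun p => splitTerm x y (splitIndex p)) (∑' q, splitTerm x y q) := by
    refine (splitIndex_injective.hasSum_iff (f := splitTerm x y) fun q hq => ?_).2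
      (summable_splitTerm x y).hasSum
    obtain ⟨n, S, T⟩ := q
    by_contra h0
    simp only [splitTerm, mul_eq_zero, not_or, div_eq_zero_iff, Finset.prod_eq_zero_iff,
      not_exists, not_and] at h0
    obtain ⟨⟨-, h1⟩, h2, h3⟩ := h0
    refine hq (mem_range_splitIndex (Nat.pos_of_ne_zero fun h => h1 (by simp [h]))
      (fun j hj => ⟨Nat.pos_of_ne_zero fun h => h2 j hj ?_, ?_⟩) fun j hj => ?_)
    · simp [lowerWeight, h]
    · by_contra h
      exact h2 j hj (by simp [lowerWeight, h])
    · by_contra h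
      exact h3 j hj (by simp [upperWeight, h])
  refine h1.sigma fun p => ?_
  simp only [splitTerm_splitIndex]
  have := (Complex.hasSum_ofReal.2 (summable_mzvTerm_twosThreeTwos p.1 p.2).hasSum).mul_left
    ((-1) ^ (p.1 + p.2 + 1) * x ^ (2 * p.1 + 2) * y ^ (2 * p.2 + 1))
  convert! this using 1
  rw [genTerm, zagierH, mzv]
  ring

lemma hasSum_const_mul_mul {ι κ : Type*} {f : ι → ℂ} {g : κ → ℂ} (hf : Summable fun i => ‖f i‖)
    (hg : Summable fun k => ‖g k‖) (c : ℂ) :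
    HasSum (fun q : ι × κ => c * (f q.1 * g q.2)) (c * ((∑' i, f i) * ∑' k, g k)) :=
  (hf.of_norm.hasSum.mul hg.of_norm.hasSum (summable_mul_of_summable_norm hf hg)).mul_left c

/-- The generating function `F(x, y)` as a single series, by summing first over the entries before
and after the one with exponent `3`. -/
lemma hasSum_zagierF (x y : ℂ) :
    HasSum (fun n : ℕ => -(x ^ 2 * y) / ((n : ℂ) + 1) ^ 3 * (eulerProd n x
      * ∑' T : Finset ℕ, ∏ j ∈ T, upperWeight y (n + 1) j)) (zagierF x y) := by
  rw [zagierF, (hasSum_genTerm_zagierH x y).tsum_eq]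
  have hfib : ∀ n : ℕ, HasSum (fun q : Finset ℕ × Finset ℕ => splitTerm x y (n, q))
      (-(x ^ 2 * y) / (n : ℂ) ^ 3 * ((∑' S : Finset ℕ, ∏ j ∈ S, lowerWeight x n j)
        * ∑' T : Finset ℕ, ∏ j ∈ T, upperWeight y n j)) := fun n => by
    simp only [splitTerm]
    exact hasSum_const_mul_mul (summable_norm_prod_lowerWeight x n)
      (summable_norm_prod_upperWeight y n) _
  have h : HasSum (fun n : ℕ => -(x ^ 2 * y) / (n : ℂ) ^ 3
      * ((∑' S : Finset ℕ, ∏ j ∈ S, lowerWeight x n j)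
        * ∑' T : Finset ℕ, ∏ j ∈ T, upperWeight y n j)) (∑' q, splitTerm x y q) :=
    HasSum.prod_fiberwise (summable_splitTerm x y).hasSum hfib
  rw [← hasSum_nat_add_iff' 1] at h
  simpa [tsum_prod_lowerWeight] using h

lemma eulerProd_ne_zero {y : ℂ} (hy : ∀ n : ℤ, y ≠ n) (n : ℕ) : eulerProd n y ≠ 0 := by
  rw [eulerProd, Finset.prod_ne_zero_iff]
  intro j _ h
  have hj : ((j : ℂ) + 1) ^ 2 ≠ 0 := pow_ne_zero _ (Nat.cast_add_one_ne_zero j)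
  rw [sub_eq_zero, eq_div_iff hj, one_mul, eq_comm, sq_eq_sq_iff_eq_or_eq_neg] at h
  rcases h with h | h
  · exact hy (j + 1) (by push_cast; exact h)
  · exact hy (-(j + 1)) (by push_cast; exact h)

/-- The term of index `n + 1` of the series `∑ (x)ₙ (-x)ₙ / (n (1 + y)ₙ (1 - y)ₙ)`, the
`z`-derivative at `0` of `₃F₂(x, -x, z; 1 + y, 1 - y; 1)`; the Pochhammer symbols are written as
factorials times partial products of Euler's product. -/
noncomputable def derivTerm (x y : ℂ) (n : ℕ) : ℂ :=
  -(x ^ 2) / ((n : ℂ) + 1) ^ 3 * (eulerProd n x / eulerProd (n + 1) y)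

/-- The relation `F(x, y) = (sin π y / π) · S(x, y)`, with `S(x, y)` the sum of the `derivTerm`s. -/
lemma hasSum_zagierF_of_notInt {x y : ℂ} (hy : ∀ n : ℤ, y ≠ n) :
    HasSum (fun n : ℕ => Complex.sin (Real.pi * y) / Real.pi * derivTerm x y n)
      (zagierF x y) := by
  refine (hasSum_zagierF x y).congr_fun fun n => ?_
  have h0 := eulerProd_ne_zero hy (n + 1)
  have hpi : (Real.pi : ℂ) ≠ 0 := by exact_mod_cast Real.pi_ne_zero
  rw [← tsum_prod_upperWeight y (n + 1), derivTerm]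
  field_simp

/-! ### The derivative of the hypergeometric series -/

lemma poch_succ (α : ℂ) (n : ℕ) : poch α (n + 1) = poch α n * (α + n) :=
  Finset.prod_range_succ _ _

lemma poch_one_add_mul_poch_one_sub (y : ℂ) (n : ℕ) :
    poch (1 + y) n * poch (1 - y) n = (n.factorial : ℂ) ^ 2 * eulerProd n y := by
  induction n with
  | zero => simp [poch, eulerProd]
  | succ n ih =>
    have hn : (n : ℂ) + 1 ≠ 0 := Nat.cast_add_one_ne_zero n
    rw [poch_succ, poch_succ, mul_mul_mul_comm, ih, eulerProd, eulerProd, Finset.prod_range_succ,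
      Nat.factorial_succ]
    push_cast
    field_simp
    ring

lemma poch_mul_poch_neg (x : ℂ) (n : ℕ) :
    poch x (n + 1) * poch (-x) (n + 1)
      = -(x ^ 2) * ((n.factorial : ℂ) ^ 2 * eulerProd n x) := by
  rw [← poch_one_add_mul_poch_one_sub]
  simp only [poch, Finset.prod_range_succ']
  have h1 : ∀ k : ℕ, x + ((k + 1 : ℕ) : ℂ) = 1 + x + k := fun k => by push_cast; ring
  have h2 : ∀ k : ℕ, -x + ((k + 1 : ℕ) : ℂ) = 1 - x + k := fun k => by push_cast; ring
  simp only [h1, h2]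
  push_cast
  ring

lemma exists_norm_le_of_tendsto {u : ℕ → ℂ} {l : ℂ} (h : Tendsto u atTop (𝓝 l)) :
    ∃ C, 0 < C ∧ ∀ n, ‖u n‖ ≤ C := by
  obtain ⟨C, hC, h⟩ := (Metric.isBounded_range_of_tendsto u h).exists_pos_norm_le
  exact ⟨C, hC, fun n => h _ ⟨n, rfl⟩⟩

lemma tendsto_eulerProd {z : ℂ} (hz : z ≠ 0) :
    Tendsto (fun n => eulerProd n z) atTop (𝓝 (Complex.sin (Real.pi * z) / (Real.pi * z))) := by
  have hpi : (Real.pi * z : ℂ) ≠ 0 := mul_ne_zero (by exact_mod_cast Real.pi_ne_zero) hz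
  refine ((Complex.tendsto_euler_sin_prod z).div_const (Real.pi * z)).congr fun n => ?_
  rw [mul_div_cancel_left₀ _ hpi, eulerProd]

lemma exists_norm_eulerProd_le (z : ℂ) : ∃ C, 0 < C ∧ ∀ n, ‖eulerProd n z‖ ≤ C := by
  rcases eq_or_ne z 0 with rfl | hz
  · exact ⟨1, one_pos, fun n => by simp [eulerProd]⟩
  · exact exists_norm_le_of_tendsto (tendsto_eulerProd hz)

lemma sin_pi_mul_ne_zero_of_notInt {y : ℂ} (hy : ∀ n : ℤ, y ≠ n) :
    Complex.sin (Real.pi * y) ≠ 0 :=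
  sin_pi_mul_ne_zero fun ⟨n, hn⟩ => hy n hn.symm

lemma exists_norm_inv_eulerProd_le {y : ℂ} (hy : ∀ n : ℤ, y ≠ n) :
    ∃ C, 0 < C ∧ ∀ n, ‖(eulerProd n y)⁻¹‖ ≤ C := by
  have hy0 : y ≠ 0 := by simpa using hy 0
  refine exists_norm_le_of_tendsto ((tendsto_eulerProd hy0).inv₀ ?_)
  exact div_ne_zero (sin_pi_mul_ne_zero_of_notInt hy)
    (mul_ne_zero (by exact_mod_cast Real.pi_ne_zero) hy0)

lemma hyp32Term_succ (x y z : ℂ) (n : ℕ) :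
    hyp32Term x (-x) z (1 + y) (1 - y) 1 (n + 1)
      = -(x ^ 2) / ((n : ℂ) + 1) ^ 2 * (eulerProd n x / eulerProd (n + 1) y)
        * (poch z (n + 1) / (n + 1).factorial) := by
  rw [hyp32Term, poch_mul_poch_neg, mul_assoc ((n + 1).factorial : ℂ),
    poch_one_add_mul_poch_one_sub, Nat.factorial_succ, one_pow, mul_one]
  have hn : (n : ℂ) + 1 ≠ 0 := Nat.cast_add_one_ne_zero n
  have hf : (n.factorial : ℂ) ≠ 0 := by exact_mod_cast n.factorial_ne_zero
  push_cast
  -- for integral `y` both sides may be divisions by zero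
  rcases eq_or_ne (eulerProd (n + 1) y) 0 with h | h
  · simp [h]
  · field_simp

lemma norm_poch_div_factorial_le {z : ℂ} (hz : ‖z‖ ≤ 1) (n : ℕ) :
    ‖poch z n / n.factorial‖ ≤ 1 := by
  induction n with
  | zero => simp [poch]
  | succ n ih =>
    have hn : (n : ℝ) + 1 ≠ 0 := Nat.cast_add_one_ne_zero n
    have h1 : ‖(z + n) / ((n : ℂ) + 1)‖ ≤ 1 := by
      have h2 : ‖(n : ℂ) + 1‖ = n + 1 := by
        rw [← Nat.cast_succ, Complex.norm_natCast, Nat.cast_succ]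
      rw [norm_div, h2, div_le_one (by positivity)]
      calc ‖z + n‖ ≤ ‖z‖ + ‖(n : ℂ)‖ := norm_add_le _ _
        _ ≤ n + 1 := by rw [Complex.norm_natCast]; linarith
    have : poch z (n + 1) / (n + 1).factorial
        = poch z n / n.factorial * ((z + n) / ((n : ℂ) + 1)) := by
      rw [poch_succ, Nat.factorial_succ]
      push_cast
      rw [mul_comm ((n : ℂ) + 1), mul_div_mul_comm]
    rw [this, norm_mul]
    exact mul_le_one₀ ih (norm_nonneg _) h1

/-- On the unit disc in `z`, the terms of the hypergeometric series are `O(1 / n²)` uniformly. -/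
lemma exists_norm_hyp32Term_le {x y : ℂ} (hy : ∀ n : ℤ, y ≠ n) :
    ∃ C, ∀ (n : ℕ) (z : ℂ), ‖z‖ ≤ 1 →
      ‖hyp32Term x (-x) z (1 + y) (1 - y) 1 (n + 1)‖ ≤ C * (1 / ((n : ℝ) + 1) ^ 2) := by
  obtain ⟨C, hC0, hC⟩ := exists_norm_eulerProd_le x
  obtain ⟨D, hD0, hD⟩ := exists_norm_inv_eulerProd_le hy
  refine ⟨‖x ^ 2‖ * (C * D), fun n z hz => ?_⟩
  have h2 : ‖(n : ℂ) + 1‖ = n + 1 := by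
    rw [← Nat.cast_succ, Complex.norm_natCast, Nat.cast_succ]
  rw [hyp32Term_succ, norm_mul, norm_mul, norm_div, norm_neg, norm_pow (_ + 1), h2,
    div_eq_mul_inv (eulerProd n x), norm_mul (eulerProd n x)]
  calc _ ≤ ‖x ^ 2‖ / ((n : ℝ) + 1) ^ 2 * (C * D) * 1 := by
        gcongr
        · exact hC n
        · exact hD (n + 1)
        · exact norm_poch_div_factorial_le hz _
    _ = _ := by ring

lemma summable_one_div_add_one_sq : Summable fun n : ℕ => 1 / ((n : ℝ) + 1) ^ 2 := by
  have := (summable_nat_add_iff 1).2 (Real.summable_one_div_nat_pow.2 one_lt_two)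
  simpa using this

lemma summable_hyp32Term {x y z : ℂ} (hy : ∀ n : ℤ, y ≠ n) (hz : ‖z‖ ≤ 1) :
    Summable (hyp32Term x (-x) z (1 + y) (1 - y) 1) := by
  obtain ⟨C, hC⟩ := exists_norm_hyp32Term_le (x := x) hy
  rw [← summable_nat_add_iff 1]
  exact (summable_one_div_add_one_sq.mul_left C).of_norm_bounded fun n => hC n z hz

lemma differentiable_poch (n : ℕ) : Differentiable ℂ fun z => poch z n := by
  simp only [poch]
  fun_prop

lemma poch_one (n : ℕ) : poch 1 n = n.factorial := by
  induction n with
  | zero => simp [poch]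
  | succ n ih =>
    rw [poch_succ, ih, Nat.factorial_succ]
    push_cast
    ring

lemma hasDerivAt_poch_zero (n : ℕ) :
    HasDerivAt (fun z => poch z (n + 1)) (n.factorial : ℂ) 0 := by
  have h : (fun z : ℂ => poch z (n + 1)) = fun z => poch (1 + z) n * z := by
    funext z
    simp only [poch, Finset.prod_range_succ']
    push_cast
    congr 1
    · exact Finset.prod_congr rfl fun k _ => by ring
    · ring
  have hd : DifferentiableAt ℂ (fun z : ℂ => poch (1 + z) n) 0 :=
    ((differentiable_poch n).comp (differentiable_const (1 : ℂ) |>.add differentiable_id)) 0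
  rw [h]
  have h1 := hd.hasDerivAt.mul (hasDerivAt_id (0 : ℂ))
  simp only [id, mul_zero, zero_add, mul_one, add_zero, poch_one] at h1
  exact h1

/-- Termwise differentiation of the hypergeometric series at `z = 0`. -/
lemma hasDerivAt_hyp32 {x y : ℂ} (hy : ∀ n : ℤ, y ≠ n) :
    Summable (derivTerm x y) ∧
      HasDerivAt (fun z => hyp32 x (-x) z (1 + y) (1 - y) 1) (∑' n, derivTerm x y n) 0 := by
  obtain ⟨C, hC⟩ := exists_norm_hyp32Term_le (x := x) hy
  let f : ℕ → ℂ → ℂ := fun n z => hyp32Term x (-x) z (1 + y) (1 - y) 1 (n + 1)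
  have hf : ∀ n, Differentiable ℂ (f n) := fun n => by
    simp only [f, hyp32Term_succ]
    exact ((differentiable_poch (n + 1)).div_const _).const_mul _
  have hb : ∀ n z, z ∈ Metric.ball (0 : ℂ) 1 → ‖f n z‖ ≤ C * (1 / ((n : ℝ) + 1) ^ 2) :=
    fun n z hz => hC n z (mem_ball_zero_iff.1 hz).le
  have h0 : (0 : ℂ) ∈ Metric.ball (0 : ℂ) 1 := by simp
  have hu := summable_one_div_add_one_sq.mul_left C
  have hd : ∀ n, deriv (f n) 0 = derivTerm x y n := fun n => by
    have hn : (n : ℂ) + 1 ≠ 0 := Nat.cast_add_one_ne_zero n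
    have hfac : (n.factorial : ℂ) ≠ 0 := by exact_mod_cast n.factorial_ne_zero
    simp only [f, hyp32Term_succ]
    rw [(((hasDerivAt_poch_zero n).div_const _).const_mul _).deriv, derivTerm, Nat.factorial_succ]
    push_cast
    field_simp
  have h1 := Complex.hasSum_deriv_of_summable_norm hu (fun n => (hf n).differentiableOn)
    Metric.isOpen_ball hb h0
  have h2 := (Complex.differentiableOn_tsum_of_summable_norm hu
    (fun n => (hf n).differentiableOn) Metric.isOpen_ball hb).differentiableAt
    (Metric.isOpen_ball.mem_nhds h0)
  simp only [hd] at h1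
  refine ⟨h1.summable, ?_⟩
  have h3 : HasDerivAt (fun z => 1 + ∑' n, f n z) (∑' n, derivTerm x y n) 0 := by
    rw [h1.tsum_eq]
    exact h2.hasDerivAt.const_add 1
  refine h3.congr_of_eventuallyEq ?_
  filter_upwards [Metric.ball_mem_nhds (0 : ℂ) one_pos] with z hz
  rw [hyp32, (summable_hyp32Term hy (mem_ball_zero_iff.1 hz).le).tsum_eq_zero_add]
  simp [f, hyp32Term, poch]

/-! ### The power series of `cos (2 x φ)` in `sin² φ` -/

/-- The coefficient `(x)ₙ (-x)ₙ / (n! (1/2)ₙ)` of `sin²ⁿ φ` in the expansion of `cos (2 x φ)`. -/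
noncomputable def cosCoeff (x : ℂ) (n : ℕ) : ℂ :=
  poch x n * poch (-x) n / (n.factorial * poch (1 / 2) n)

/-- The bound `n! / 2 ≤ (1/2)ₙ₊₁`, where `(1/2)ₙ₊₁` is real. -/
lemma poch_half_ofReal (n : ℕ) : ∃ r : ℝ, poch (1 / 2) (n + 1) = r ∧ (n.factorial : ℝ) / 2 ≤ r := by
  induction n with
  | zero => exact ⟨1 / 2, by simp [poch], by simp⟩
  | succ n ih =>
    obtain ⟨r, h1, h2⟩ := ih
    refine ⟨r * (1 / 2 + (n + 1)), by rw [poch_succ, h1]; push_cast; ring, ?_⟩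
    rw [Nat.factorial_succ]
    push_cast
    have hn : (0 : ℝ) ≤ n.factorial := by positivity
    have hn' : (0 : ℝ) ≤ n := by positivity
    nlinarith [mul_le_mul_of_nonneg_right h2 (by linarith : (0 : ℝ) ≤ 1 / 2 + (n + 1))]

lemma poch_half_ne_zero (n : ℕ) : poch (1 / 2) n ≠ 0 := by
  cases n with
  | zero => simp [poch]
  | succ n =>
    obtain ⟨r, h1, h2⟩ := poch_half_ofReal n
    have : (0 : ℝ) < n.factorial := by positivity
    rw [h1]
    exact_mod_cast (by linarith : (0 : ℝ) < r).ne'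

lemma cosCoeff_zero (x : ℂ) : cosCoeff x 0 = 1 := by simp [cosCoeff, poch]

lemma cosCoeff_succ (x : ℂ) (n : ℕ) :
    cosCoeff x (n + 1) * ((2 * n + 2) * (2 * n + 1)) = cosCoeff x n * (4 * (n ^ 2 - x ^ 2)) := by
  have h1 : (n : ℂ) + 1 ≠ 0 := Nat.cast_add_one_ne_zero n
  have h2 : (n.factorial : ℂ) ≠ 0 := by exact_mod_cast n.factorial_ne_zero
  have h3 := poch_half_ne_zero n
  have h4 := poch_half_ne_zero (n + 1)
  rw [poch_succ] at h4
  simp only [cosCoeff, poch_succ, Nat.factorial_succ]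
  push_cast
  rw [div_mul_eq_mul_div, div_mul_eq_mul_div, div_eq_div_iff
    (mul_ne_zero (mul_ne_zero h1 h2) h4) (mul_ne_zero h2 h3)]
  ring

lemma cosCoeff_succ_eq (x : ℂ) (n : ℕ) : cosCoeff x (n + 1) =
    -(x ^ 2) * ((n.factorial : ℂ) ^ 2 * eulerProd n x)
      / ((n + 1).factorial * poch (1 / 2) (n + 1)) := by
  rw [cosCoeff, poch_mul_poch_neg]

lemma exists_norm_cosCoeff_le (x : ℂ) :
    ∃ C, 0 < C ∧ ∀ n : ℕ, ‖cosCoeff x (n + 1)‖ ≤ C * (1 / ((n : ℝ) + 1)) := by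
  obtain ⟨C, hC0, hC⟩ := exists_norm_eulerProd_le x
  refine ⟨(‖x ^ 2‖ + 1) * C * 2, by positivity, fun n => ?_⟩
  obtain ⟨r, h1, h2⟩ := poch_half_ofReal n
  have hf : (0 : ℝ) < n.factorial := by positivity
  have hr : 0 < r := by linarith
  rw [cosCoeff_succ_eq, h1, norm_div, norm_mul, norm_mul, norm_mul, norm_neg, norm_pow, norm_pow,
    Complex.norm_natCast, Complex.norm_natCast, Complex.norm_real, Real.norm_of_nonneg hr.le,
    div_le_iff₀ (by positivity), Nat.factorial_succ]
  push_cast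
  calc ‖x‖ ^ 2 * ((n.factorial : ℝ) ^ 2 * ‖eulerProd n x‖)
      ≤ (‖x‖ ^ 2 + 1) * ((n.factorial : ℝ) ^ 2 * C) := by
        gcongr
        · linarith
        · exact hC n
    _ = (‖x‖ ^ 2 + 1) * C * 2 * (n.factorial * (n.factorial / 2)) := by ring
    _ ≤ (‖x‖ ^ 2 + 1) * C * 2 * (n.factorial * r) := by gcongr
    _ = _ := by field_simp

lemma hasDerivAt_sin_lin (x a z : ℂ) :
    HasDerivAt (fun z => Complex.sin (a - 2 * x * z))
      (-(2 * x) * Complex.cos (a - 2 * x * z)) z := by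
  have := (((hasDerivAt_id z).const_mul (2 * x)).const_sub a).csin
  simp only [id] at this
  convert! this using 1
  ring

lemma hasDerivAt_cos_lin (x a z : ℂ) :
    HasDerivAt (fun z => Complex.cos (a - 2 * x * z))
      (2 * x * Complex.sin (a - 2 * x * z)) z := by
  have := (((hasDerivAt_id z).const_mul (2 * x)).const_sub a).ccos
  simp only [id] at this
  convert! this using 1
  ring

/-- The kernel integral `∫₀^φ sin²ᵏ s · sin (2x (φ - s)) ds` solving `u'' + 4x² u = 2x sin²ᵏ`. -/
noncomputable def kernelInt (x : ℂ) (φ : ℝ) (k : ℕ) : ℂ :=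
  ∫ s in (0 : ℝ)..φ, Complex.sin s ^ (2 * k) * Complex.sin (2 * x * φ - 2 * x * s)

lemma hasDerivAt_sin_pow (k : ℕ) (z : ℂ) :
    HasDerivAt (fun z => Complex.sin z ^ (k + 1))
      ((k + 1) * Complex.sin z ^ k * Complex.cos z) z := by
  simpa using (Complex.hasDerivAt_sin z).fun_pow (k + 1)

lemma kernelInt_zero (x : ℂ) (φ : ℝ) :
    2 * x - 2 * x * Complex.cos (2 * x * φ) = 4 * x ^ 2 * kernelInt x φ 0 := by
  have h : ∀ s : ℝ, HasDerivAt (fun s : ℝ => 2 * x * Complex.cos (2 * x * φ - 2 * x * s))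
      (4 * x ^ 2 * (Complex.sin s ^ (2 * 0) * Complex.sin (2 * x * φ - 2 * x * s))) s := fun s => by
    have := ((hasDerivAt_cos_lin x (2 * x * φ) s).const_mul (2 * x)).comp_ofReal
    convert! this using 1
    simp only [mul_zero, pow_zero, one_mul]
    ring
  rw [kernelInt, ← intervalIntegral.integral_const_mul,
    intervalIntegral.integral_eq_sub_of_hasDerivAt (fun s _ => h s)
      (Continuous.intervalIntegrable (by fun_prop) _ _)]
  simp

/-- Two integrations by parts, in the form of an explicit antiderivative. -/
lemma kernelInt_succ (x : ℂ) (φ : ℝ) (k : ℕ) :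
    2 * x * Complex.sin φ ^ (2 * k + 2) = (2 * k + 2) * (2 * k + 1) * kernelInt x φ k
      + (4 * x ^ 2 - 4 * (k + 1) ^ 2) * kernelInt x φ (k + 1) := by
  have h : ∀ s : ℝ, HasDerivAt (fun s : ℝ =>
      (2 * k + 2) * (Complex.sin s ^ (2 * k + 1) * Complex.cos s
        * Complex.sin (2 * x * φ - 2 * x * s))
      + 2 * x * (Complex.sin s ^ (2 * k + 2) * Complex.cos (2 * x * φ - 2 * x * s)))
      ((2 * k + 2) * (2 * k + 1)
          * (Complex.sin s ^ (2 * k) * Complex.sin (2 * x * φ - 2 * x * s))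
        + (4 * x ^ 2 - 4 * (k + 1) ^ 2)
          * (Complex.sin s ^ (2 * (k + 1)) * Complex.sin (2 * x * φ - 2 * x * s))) s := fun s => by
    have h1 := (((hasDerivAt_sin_pow (2 * k) s).mul (Complex.hasDerivAt_cos s)).mul
      (hasDerivAt_sin_lin x (2 * x * φ) s)).const_mul (2 * (k : ℂ) + 2)
    have h2 := ((hasDerivAt_sin_pow (2 * k + 1) s).mul
      (hasDerivAt_cos_lin x (2 * x * φ) s)).const_mul (2 * x)
    have := (h1.add h2).comp_ofReal
    convert! this using 1
    have hcs : Complex.cos s ^ 2 = 1 - Complex.sin s ^ 2 := by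
      linear_combination Complex.sin_sq_add_cos_sq s
    simp only [Pi.mul_apply]
    push_cast
    linear_combination (-(2 * (k : ℂ) + 2) * (2 * k + 1) * Complex.sin s ^ (2 * k)
      * Complex.sin (2 * x * φ - 2 * x * s)) * hcs
  rw [kernelInt, kernelInt, ← intervalIntegral.integral_const_mul,
    ← intervalIntegral.integral_const_mul, ← intervalIntegral.integral_add
      (Continuous.intervalIntegrable (by fun_prop) _ _)
      (Continuous.intervalIntegrable (by fun_prop) _ _),
    intervalIntegral.integral_eq_sub_of_hasDerivAt (fun s _ => h s)
      (Continuous.intervalIntegrable (by fun_prop) _ _)]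
  simp

/-- The remainder of the expansion of `cos (2 x φ)` in powers of `sin² φ`. -/
lemma sum_cosCoeff (x : ℂ) (φ : ℝ) (N : ℕ) :
    2 * x * (∑ k ∈ Finset.range (N + 1), cosCoeff x k * Complex.sin φ ^ (2 * k)
      - Complex.cos (2 * x * φ)) = cosCoeff x N * (4 * x ^ 2 - 4 * N ^ 2) * kernelInt x φ N := by
  induction N with
  | zero =>
    have := kernelInt_zero x φ
    simp only [zero_add, Finset.sum_range_one, cosCoeff_zero, mul_zero, pow_zero]
    push_cast
    linear_combination this
  | succ N ih =>
    rw [Finset.sum_range_succ]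
    have h1 := kernelInt_succ x φ N
    have h2 := cosCoeff_succ x N
    push_cast
    rw [show 2 * (N + 1) = 2 * N + 2 by ring]
    linear_combination ih + cosCoeff x (N + 1) * h1 + kernelInt x φ N * h2

/-- The expansion `cos 2xφ = ∑ (x)ₙ (-x)ₙ / (n! (1/2)ₙ) sin²ⁿ φ` for `0 ≤ φ < π / 2`: the remainder
is `O(N² sin²ᴺ φ)`. -/
lemma hasSum_cosCoeff (x : ℂ) {φ : ℝ} (h0 : 0 ≤ φ) (h1 : φ < Real.pi / 2) :
    HasSum (fun n => cosCoeff x n * Complex.sin φ ^ (2 * n)) (Complex.cos (2 * x * φ)) := by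
  rcases eq_or_ne x 0 with rfl | hx
  · have : Complex.cos (2 * 0 * φ) = cosCoeff 0 0 * Complex.sin φ ^ (2 * 0) := by
      simp [cosCoeff_zero]
    rw [this]
    refine hasSum_single 0 fun n hn => ?_
    obtain ⟨m, rfl⟩ := Nat.exists_eq_succ_of_ne_zero hn
    simp [cosCoeff_succ_eq]
  obtain ⟨C, hC0, hC⟩ := exists_norm_cosCoeff_le x
  have hC' : ∀ n, ‖cosCoeff x n‖ ≤ C + 1 := by
    rintro (_ | n)
    · rw [cosCoeff_zero, norm_one]
      linarith
    · refine (hC n).trans ((mul_le_of_le_one_right hC0.le ?_).trans (by linarith))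
      rw [div_le_one (by positivity)]
      linarith [(n.cast_nonneg : (0 : ℝ) ≤ n)]
  have hs0 : 0 ≤ Real.sin φ := Real.sin_nonneg_of_nonneg_of_le_pi h0 (by linarith [Real.pi_pos])
  have hs1 : Real.sin φ ^ 2 < 1 := by
    have := Real.cos_pos_of_mem_Ioo ⟨by linarith [Real.pi_pos], h1⟩
    nlinarith [Real.sin_sq_add_cos_sq φ]
  have hnorm : ∀ (s : ℝ), 0 ≤ Real.sin s → ∀ n, ‖Complex.sin s ^ (2 * n)‖ = (Real.sin s ^ 2) ^ n :=
    fun s hs n => by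
      rw [← Complex.ofReal_sin, norm_pow, Complex.norm_real, Real.norm_of_nonneg hs, pow_mul]
  have hsum : Summable fun n => cosCoeff x n * Complex.sin φ ^ (2 * n) := by
    refine ((summable_geometric_of_lt_one (sq_nonneg _) hs1).mul_left (C + 1)).of_norm_bounded
      fun n => ?_
    rw [norm_mul, hnorm φ hs0]
    exact mul_le_mul_of_nonneg_right (hC' n) (by positivity)
  obtain ⟨M, hM⟩ := (isCompact_Icc (a := (0 : ℝ)) (b := φ)).exists_bound_of_continuousOn
    (f := fun s : ℝ => Complex.sin (2 * x * φ - 2 * x * s)) (by fun_prop)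
  have hM0 : 0 ≤ M := (norm_nonneg _).trans (hM 0 ⟨le_rfl, h0⟩)
  have hK : ∀ N, ‖kernelInt x φ N‖ ≤ (Real.sin φ ^ 2) ^ N * M * φ := fun N => by
    refine (intervalIntegral.norm_integral_le_of_norm_le_const
      (C := (Real.sin φ ^ 2) ^ N * M) fun s hs => ?_).trans ?_
    · rw [Set.uIoc_of_le h0] at hs
      have hss : 0 ≤ Real.sin s :=
        Real.sin_nonneg_of_nonneg_of_le_pi hs.1.le (by linarith [Real.pi_pos, hs.2])
      have hle : Real.sin s ≤ Real.sin φ :=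
        Real.sin_le_sin_of_le_of_le_pi_div_two (by linarith [Real.pi_pos, hs.1]) h1.le hs.2
      rw [norm_mul, hnorm s hss]
      gcongr
      exact hM s ⟨hs.1.le, hs.2⟩
    · rw [sub_zero, abs_of_nonneg h0]
  have hlim : Tendsto (fun N : ℕ => cosCoeff x N * (4 * x ^ 2 - 4 * N ^ 2) * kernelInt x φ N)
      atTop (𝓝 0) := by
    have e1 := tendsto_pow_const_mul_const_pow_of_lt_one 2 (sq_nonneg (Real.sin φ)) hs1
    have e2 := tendsto_pow_atTop_nhds_zero_of_lt_one (sq_nonneg (Real.sin φ)) hs1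
    have e3 := ((e2.const_mul (4 * ‖x‖ ^ 2)).add (e1.const_mul 4)).const_mul ((C + 1) * (M * φ))
    simp only [mul_zero, add_zero] at e3
    refine squeeze_zero_norm (fun N => ?_) e3
    rw [norm_mul, norm_mul]
    have : ‖4 * x ^ 2 - 4 * (N : ℂ) ^ 2‖ ≤ 4 * ‖x‖ ^ 2 + 4 * (N : ℝ) ^ 2 := by
      refine (norm_sub_le _ _).trans (le_of_eq ?_)
      simp
    calc _ ≤ (C + 1) * (4 * ‖x‖ ^ 2 + 4 * (N : ℝ) ^ 2) * ((Real.sin φ ^ 2) ^ N * M * φ) := by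
          gcongr
          · exact hC' N
          · exact hK N
      _ = _ := by ring
  have h2x : (2 * x : ℂ) ≠ 0 := mul_ne_zero two_ne_zero hx
  have hpart : Tendsto (fun N : ℕ => ∑ k ∈ Finset.range (N + 1),
      cosCoeff x k * Complex.sin φ ^ (2 * k)) atTop (𝓝 (Complex.cos (2 * x * φ))) := by
    have := (hlim.const_mul (2 * x)⁻¹).add_const (Complex.cos (2 * x * φ))
    rw [mul_zero, zero_add] at this
    refine this.congr fun N => ?_
    rw [← sum_cosCoeff, inv_mul_cancel_left₀ h2x, sub_add_cancel]
  have := hsum.hasSum.tendsto_sum_nat.comp (tendsto_add_atTop_nat 1)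
  rw [← tendsto_nhds_unique this hpart]
  exact hsum.hasSum

/-! ### An integral for the derivative of the hypergeometric series -/

/-- The moment `∫₀^{π/2} sin²ⁿ φ · cos (y (π - 2φ)) dφ`. -/
noncomputable def momentInt (y : ℂ) (n : ℕ) : ℂ :=
  ∫ s in (0 : ℝ)..(Real.pi / 2),
    Complex.sin s ^ (2 * n) * Complex.cos (Real.pi * y - 2 * y * s)

lemma pi_mul_sub_two_mul (y : ℂ) :
    (Real.pi : ℂ) * y - 2 * y * ((Real.pi / 2 : ℝ) : ℂ) = 0 := by
  push_cast
  ring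

lemma cos_ofReal_pi_div_two : Complex.cos ((Real.pi / 2 : ℝ) : ℂ) = 0 := by
  rw [← Complex.ofReal_cos, Real.cos_pi_div_two, Complex.ofReal_zero]

lemma momentInt_zero (y : ℂ) : 2 * y * momentInt y 0 = Complex.sin (Real.pi * y) := by
  have h : ∀ s : ℝ, HasDerivAt (fun s : ℝ => -Complex.sin (Real.pi * y - 2 * y * s))
      (2 * y * (Complex.sin s ^ (2 * 0) * Complex.cos (Real.pi * y - 2 * y * s))) s := fun s => by
    convert! ((hasDerivAt_sin_lin y (Real.pi * y) s).neg).comp_ofReal using 1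
    simp
  rw [momentInt, ← intervalIntegral.integral_const_mul,
    intervalIntegral.integral_eq_sub_of_hasDerivAt (fun s _ => h s)
      (Continuous.intervalIntegrable (by fun_prop) _ _), pi_mul_sub_two_mul]
  simp

/-- Two integrations by parts, in the form of an explicit antiderivative. -/
lemma momentInt_succ (y : ℂ) (n : ℕ) :
    4 * (((n : ℂ) + 1) ^ 2 - y ^ 2) * momentInt y (n + 1)
      = (2 * n + 2) * (2 * n + 1) * momentInt y n := by
  have h : ∀ s : ℝ, HasDerivAt (fun s : ℝ =>
      (2 * n + 2) * (Complex.sin s ^ (2 * n + 1) * Complex.cos s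
        * Complex.cos (Real.pi * y - 2 * y * s))
      - 2 * y * (Complex.sin s ^ (2 * n + 2) * Complex.sin (Real.pi * y - 2 * y * s)))
      ((2 * n + 2) * (2 * n + 1)
          * (Complex.sin s ^ (2 * n) * Complex.cos (Real.pi * y - 2 * y * s))
        - 4 * (((n : ℂ) + 1) ^ 2 - y ^ 2)
          * (Complex.sin s ^ (2 * (n + 1)) * Complex.cos (Real.pi * y - 2 * y * s))) s :=
    fun s => by
    have h1 := (((hasDerivAt_sin_pow (2 * n) s).mul (Complex.hasDerivAt_cos s)).mul
      (hasDerivAt_cos_lin y (Real.pi * y) s)).const_mul (2 * (n : ℂ) + 2)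
    have h2 := ((hasDerivAt_sin_pow (2 * n + 1) s).mul
      (hasDerivAt_sin_lin y (Real.pi * y) s)).const_mul (2 * y)
    convert! (h1.sub h2).comp_ofReal using 1
    have hcs : Complex.cos s ^ 2 = 1 - Complex.sin s ^ 2 := by
      linear_combination Complex.sin_sq_add_cos_sq s
    simp only [Pi.mul_apply]
    push_cast
    linear_combination (-(2 * (n : ℂ) + 2) * (2 * n + 1) * Complex.sin s ^ (2 * n)
      * Complex.cos (Real.pi * y - 2 * y * s)) * hcs
  have hi := intervalIntegral.integral_eq_sub_of_hasDerivAt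
    (a := 0) (b := Real.pi / 2) (fun s _ => h s)
    (Continuous.intervalIntegrable (by fun_prop) _ _)
  rw [intervalIntegral.integral_sub
      (Continuous.intervalIntegrable (by fun_prop) _ _)
      (Continuous.intervalIntegrable (by fun_prop) _ _), intervalIntegral.integral_const_mul,
    intervalIntegral.integral_const_mul, pi_mul_sub_two_mul, cos_ofReal_pi_div_two] at hi
  simp only [Complex.ofReal_zero, Complex.sin_zero, mul_zero, zero_mul, sub_zero, ne_eq,
    Nat.add_eq_zero_iff, OfNat.ofNat_ne_zero, and_false, not_false_eq_true, zero_pow,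
    one_ne_zero] at hi
  rw [momentInt, momentInt]
  linear_combination -hi

lemma momentInt_eq {y : ℂ} (hy : ∀ n : ℤ, y ≠ n) (n : ℕ) :
    momentInt y n = Complex.sin (Real.pi * y) / (2 * y)
      * (poch (1 / 2) n / (n.factorial * eulerProd n y)) := by
  have hy0 : y ≠ 0 := by simpa using hy 0
  induction n with
  | zero =>
    have := momentInt_zero y
    rw [← this]
    simp only [poch, eulerProd, Finset.prod_range_zero, Nat.factorial_zero]
    push_cast
    field_simp
  | succ n ih =>
    have h := momentInt_succ y n
    have hE := eulerProd_ne_zero hy n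
    have hE' := eulerProd_ne_zero hy (n + 1)
    have hn : (n : ℂ) + 1 ≠ 0 := Nat.cast_add_one_ne_zero n
    have hf : (n.factorial : ℂ) ≠ 0 := by exact_mod_cast n.factorial_ne_zero
    have hEs : eulerProd (n + 1) y * (n + 1) ^ 2
        = eulerProd n y * (((n : ℂ) + 1) ^ 2 - y ^ 2) := by
      rw [eulerProd, eulerProd, Finset.prod_range_succ]
      field_simp
    have hd : ((n : ℂ) + 1) ^ 2 - y ^ 2 ≠ 0 := fun h0 => by
      rw [h0, mul_zero] at hEs
      exact (mul_ne_zero hE' (pow_ne_zero 2 hn)) hEs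
    rw [ih] at h
    rw [poch_succ, Nat.factorial_succ]
    generalize poch (1 / 2) n = p at *
    push_cast
    have h4 : 4 * (((n : ℂ) + 1) ^ 2 - y ^ 2) ≠ 0 := mul_ne_zero (by norm_num) hd
    have hE'' : eulerProd (n + 1) y
        = eulerProd n y * (((n : ℂ) + 1) ^ 2 - y ^ 2) / (n + 1) ^ 2 := by
      rw [← hEs]
      field_simp
    refine mul_left_cancel₀ h4 (h.trans ?_)
    rw [hE'']
    field_simp
    ring

lemma integral_sin_pow_mul_cos (y : ℂ) (n : ℕ) :
    ((n : ℂ) + 1) * ∫ s in (0 : ℝ)..(Real.pi / 2), Complex.sin s ^ (2 * n + 1) * Complex.cos s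
      * Complex.sin (Real.pi * y - 2 * y * s) = y * momentInt y (n + 1) := by
  have h : ∀ s : ℝ, HasDerivAt (fun s : ℝ =>
      Complex.sin s ^ (2 * n + 2) * Complex.sin (Real.pi * y - 2 * y * s))
      (2 * (((n : ℂ) + 1) * (Complex.sin s ^ (2 * n + 1) * Complex.cos s
        * Complex.sin (Real.pi * y - 2 * y * s))
        - y * (Complex.sin s ^ (2 * (n + 1)) * Complex.cos (Real.pi * y - 2 * y * s)))) s :=
    fun s => by
    convert! ((hasDerivAt_sin_pow (2 * n + 1) s).mul
      (hasDerivAt_sin_lin y (Real.pi * y) s)).comp_ofReal using 1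
    push_cast
    ring
  have hi := intervalIntegral.integral_eq_sub_of_hasDerivAt
    (a := 0) (b := Real.pi / 2) (fun s _ => h s)
    (Continuous.intervalIntegrable (by fun_prop) _ _)
  rw [intervalIntegral.integral_const_mul, intervalIntegral.integral_sub
      (Continuous.intervalIntegrable (by fun_prop) _ _)
      (Continuous.intervalIntegrable (by fun_prop) _ _), intervalIntegral.integral_const_mul,
    intervalIntegral.integral_const_mul, pi_mul_sub_two_mul] at hi
  simp only [Complex.ofReal_zero, Complex.sin_zero, mul_zero, zero_mul, sub_zero, ne_eq,
    Nat.add_eq_zero_iff, OfNat.ofNat_ne_zero, and_false, not_false_eq_true, zero_pow] at hi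
  rw [momentInt]
  linear_combination hi / 2

/-- The termwise integral equals, up to a constant, the term of the differentiated
hypergeometric series. -/
lemma cosCoeff_mul_integral {x y : ℂ} (hy : ∀ n : ℤ, y ≠ n) (n : ℕ) :
    ∫ s in (0 : ℝ)..(Real.pi / 2), cosCoeff x (n + 1) * (Complex.sin s ^ (2 * n + 1)
      * Complex.cos s * Complex.sin (Real.pi * y - 2 * y * s))
      = Complex.sin (Real.pi * y) / 2 * derivTerm x y n := by
  have hy0 : y ≠ 0 := by simpa using hy 0
  have hn : (n : ℂ) + 1 ≠ 0 := Nat.cast_add_one_ne_zero n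
  have hf : (n.factorial : ℂ) ≠ 0 := by exact_mod_cast n.factorial_ne_zero
  have hE' := eulerProd_ne_zero hy (n + 1)
  have hp := poch_half_ne_zero (n + 1)
  have h := integral_sin_pow_mul_cos y n
  rw [momentInt_eq hy] at h
  rw [intervalIntegral.integral_const_mul, cosCoeff_succ_eq, derivTerm]
  rw [Nat.factorial_succ] at h ⊢
  generalize poch (1 / 2) (n + 1) = p at *
  refine mul_left_cancel₀ hn ?_
  rw [mul_left_comm, h]
  push_cast
  field_simp

/-- The integrand `(cos 2xs - 1) cot s · sin (y (π - 2s))`; it is bounded on `(0, π / 2)`. -/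
noncomputable def cotIntegrand (x y : ℂ) (s : ℝ) : ℂ :=
  (Complex.cos (2 * x * s) - 1) * (Complex.cos s / Complex.sin s)
    * Complex.sin (Real.pi * y - 2 * y * s)

lemma exists_norm_sin_lin_le (y : ℂ) : ∃ C, 0 < C ∧ ∀ s ∈ Set.Icc (0 : ℝ) (Real.pi / 2),
    ‖Complex.sin (Real.pi * y - 2 * y * s)‖ ≤ C := by
  obtain ⟨C, hC⟩ := (isCompact_Icc (a := (0 : ℝ)) (b := Real.pi / 2)).exists_bound_of_continuousOn
    (f := fun s : ℝ => Complex.sin (Real.pi * y - 2 * y * s)) (by fun_prop)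
  exact ⟨max C 1, by positivity, fun s hs => (hC s hs).trans (le_max_left _ _)⟩

lemma norm_cos_ofReal_le (s : ℝ) : ‖Complex.cos s‖ ≤ 1 := by
  rw [← Complex.ofReal_cos, Complex.norm_real]
  exact Real.abs_cos_le_one s

lemma integrableOn_cotIntegrand (x y : ℂ) :
    MeasureTheory.IntegrableOn (cotIntegrand x y) (Set.Ioo 0 (Real.pi / 2)) := by
  obtain ⟨C, hC0, hC⟩ := exists_norm_sin_lin_le y
  obtain ⟨D, hD⟩ := (isCompact_Icc (a := (0 : ℝ)) (b := Real.pi / 2)).exists_bound_of_continuousOn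
    (f := fun s : ℝ => 2 * x * Complex.sin (0 - 2 * x * s)) (by fun_prop)
  have hD0 : 0 ≤ D := (norm_nonneg _).trans (hD 0 ⟨le_rfl, by positivity⟩)
  have hlip : ∀ s ∈ Set.Icc (0 : ℝ) (Real.pi / 2), ‖Complex.cos (2 * x * s) - 1‖ ≤ D * s := by
    intro s hs
    have := (convex_Icc (0 : ℝ) (Real.pi / 2)).norm_image_sub_le_of_norm_hasDerivWithin_le
      (f := fun s : ℝ => Complex.cos (0 - 2 * x * s)) (C := D)
      (fun t _ => (hasDerivAt_cos_lin x 0 t).comp_ofReal.hasDerivWithinAt) hD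
      (Set.left_mem_Icc.2 (by positivity)) hs
    simpa [abs_of_nonneg hs.1] using this
  refine MeasureTheory.Measure.integrableOn_of_bounded (M := D * (Real.pi / 2) * C) (by simp) ?_ ?_
  · refine Measurable.aestronglyMeasurable ?_
    unfold cotIntegrand
    fun_prop
  · refine (MeasureTheory.ae_restrict_iff' measurableSet_Ioo).2 (.of_forall fun s hs => ?_)
    have hs' : s ∈ Set.Icc (0 : ℝ) (Real.pi / 2) := Set.Ioo_subset_Icc_self hs
    have hsin := Real.mul_le_sin hs.1.le hs.2.le
    have hpos : 0 < 2 / Real.pi * s := mul_pos (by positivity) hs.1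
    rw [cotIntegrand, norm_mul, norm_mul, norm_div]
    have h1 : ‖Complex.sin s‖ = Real.sin s := by
      rw [← Complex.ofReal_sin, Complex.norm_real, Real.norm_of_nonneg (hpos.le.trans hsin)]
    rw [h1]
    -- `1 / sin s` is controlled by Jordan's inequality `2 s / π ≤ sin s`
    have hs1 := hs.1
    have hsin0 : 0 ≤ Real.sin s := hpos.le.trans hsin
    calc _ ≤ D * s * (1 / (2 / Real.pi * s)) * C := by
          gcongr
          · exact hlip s hs'
          · exact norm_cos_ofReal_le s
          · exact hC s hs'
      _ = D * (Real.pi / 2) * C := by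
          have := hs.1.ne'
          field_simp

/-- The integral formula
`(sin π y / 2) · S(x, y) = ∫₀^{π/2} (cos 2xφ - 1) cot φ sin (y (π - 2φ)) dφ`. -/
lemma hasSum_integral_cotIntegrand {x y : ℂ} (hy : ∀ n : ℤ, y ≠ n) :
    HasSum (fun n => Complex.sin (Real.pi * y) / 2 * derivTerm x y n)
      (∫ s in (0 : ℝ)..(Real.pi / 2), cotIntegrand x y s) := by
  have hpi : (0 : ℝ) ≤ Real.pi / 2 := by positivity
  let F : ℕ → ℝ → ℂ := fun n s => cosCoeff x (n + 1) * (Complex.sin s ^ (2 * n + 1)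
    * Complex.cos s * Complex.sin (Real.pi * y - 2 * y * s))
  have hFc : ∀ n, Continuous (F n) := fun n => by fun_prop
  obtain ⟨C, hC0, hC⟩ := exists_norm_sin_lin_le y
  obtain ⟨D, hD0, hD⟩ := exists_norm_cosCoeff_le x
  have hbound : ∀ n, ∫ s in Set.Ioo 0 (Real.pi / 2), ‖F n s‖
      ≤ D * C * (1 / ((n : ℝ) + 1) ^ 2) := fun n => by
    have h1 : ∀ s : ℝ, HasDerivAt (fun s : ℝ => Real.sin s ^ (2 * n + 2) / (2 * n + 2))
        (Real.sin s ^ (2 * n + 1) * Real.cos s) s := fun s => by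
      have := ((Real.hasDerivAt_sin s).fun_pow (2 * n + 2)).div_const (2 * (n : ℝ) + 2)
      convert! this using 1
      push_cast
      have : (2 * (n : ℝ) + 2) ≠ 0 := by positivity
      field_simp
    have h2 : ∫ s in (0 : ℝ)..(Real.pi / 2), D * (1 / ((n : ℝ) + 1)) * C
        * (Real.sin s ^ (2 * n + 1) * Real.cos s)
        = D * (1 / ((n : ℝ) + 1)) * C * (1 / (2 * n + 2)) := by
      rw [intervalIntegral.integral_const_mul,
        intervalIntegral.integral_eq_sub_of_hasDerivAt (fun s _ => h1 s)
        (Continuous.intervalIntegrable (by fun_prop) _ _)]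
      simp
    rw [← MeasureTheory.integral_Ioc_eq_integral_Ioo, ← intervalIntegral.integral_of_le hpi]
    refine (intervalIntegral.integral_mono_on hpi
      ((hFc n).norm.intervalIntegrable _ _)
      (g := fun s => D * (1 / ((n : ℝ) + 1)) * C * (Real.sin s ^ (2 * n + 1) * Real.cos s))
      (Continuous.intervalIntegrable (by fun_prop) _ _) fun s hs => ?_).trans ?_
    · have hs0 : 0 ≤ Real.sin s :=
        Real.sin_nonneg_of_nonneg_of_le_pi hs.1 (by linarith [hs.2, Real.pi_pos])
      have hc0 : 0 ≤ Real.cos s :=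
        Real.cos_nonneg_of_neg_pi_div_two_le_of_le (by linarith [hs.1, Real.pi_pos]) hs.2
      simp only [F]
      rw [norm_mul, norm_mul, norm_mul, norm_pow, ← Complex.ofReal_sin, ← Complex.ofReal_cos,
        Complex.norm_real, Complex.norm_real, Real.norm_of_nonneg hs0, Real.norm_of_nonneg hc0]
      calc _ ≤ D * (1 / ((n : ℝ) + 1)) * (Real.sin s ^ (2 * n + 1) * Real.cos s * C) := by
            gcongr
            · exact hD n
            · exact hC s hs
        _ = _ := by ring
    · rw [h2]
      calc D * (1 / ((n : ℝ) + 1)) * C * (1 / (2 * n + 2))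
          = D * C * (1 / ((n : ℝ) + 1) ^ 2) / 2 := by field_simp
        _ ≤ _ := half_le_self (by positivity)
  have hsum := MeasureTheory.hasSum_integral_of_summable_integral_norm
    (μ := MeasureTheory.volume.restrict (Set.Ioo 0 (Real.pi / 2))) (F := F)
    (fun n => ((hFc n).integrableOn_Icc.mono_set Set.Ioo_subset_Icc_self))
    ((summable_one_div_add_one_sq.mul_left (D * C)).of_nonneg_of_le
      (fun n => MeasureTheory.integral_nonneg fun s => norm_nonneg _) hbound)
  have hterm : ∀ n, ∫ s in Set.Ioo 0 (Real.pi / 2), F n s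
      = Complex.sin (Real.pi * y) / 2 * derivTerm x y n := fun n => by
    rw [← cosCoeff_mul_integral hy, intervalIntegral.integral_of_le hpi,
      MeasureTheory.integral_Ioc_eq_integral_Ioo]
  have hlim : ∫ s in Set.Ioo 0 (Real.pi / 2), ∑' n, F n s
      = ∫ s in (0 : ℝ)..(Real.pi / 2), cotIntegrand x y s := by
    rw [intervalIntegral.integral_of_le hpi, MeasureTheory.integral_Ioc_eq_integral_Ioo]
    refine MeasureTheory.setIntegral_congr_fun measurableSet_Ioo fun s hs => ?_
    have hsin : Complex.sin s ≠ 0 := by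
      rw [← Complex.ofReal_sin]
      exact_mod_cast (Real.sin_pos_of_pos_of_lt_pi hs.1 (by linarith [hs.2, Real.pi_pos])).ne'
    have h1 := (hasSum_nat_add_iff' 1).2 (hasSum_cosCoeff x hs.1.le hs.2)
    rw [Finset.sum_range_one, cosCoeff_zero, mul_zero, pow_zero, mul_one] at h1
    have h2 := h1.mul_right (Complex.cos s / Complex.sin s
      * Complex.sin (Real.pi * y - 2 * y * s))
    refine (HasSum.tsum_eq ?_).trans (b := (Complex.cos (2 * x * s) - 1)
      * (Complex.cos s / Complex.sin s * Complex.sin (Real.pi * y - 2 * y * s))) ?_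
    · refine h2.congr_fun fun n => ?_
      simp only [F]
      rw [show 2 * (n + 1) = 2 * n + 1 + 1 by ring, pow_succ (Complex.sin (s : ℂ)) (2 * n + 1)]
      field_simp
    · rw [cotIntegrand]
      ring
  simpa only [hterm, hlim] using hsum

/-! ### The partial fraction expansion -/

/-- Riemann–Lebesgue along the frequencies `c N`. -/
lemma tendsto_integral_exp_mul {f : ℝ → ℂ} {c : ℝ} (hc : c ≠ 0) :
    Tendsto (fun N : ℕ => ∫ v : ℝ, Complex.exp (c * N * v * Complex.I) * f v) atTop (𝓝 0) := by
  have hw : Tendsto (fun N : ℕ => -(c * N) / (2 * Real.pi)) atTop (cocompact ℝ) := by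
    rw [← Metric.cobounded_eq_cocompact, ← tendsto_norm_atTop_iff_cobounded]
    have h1 : ∀ N : ℕ, ‖-(c * N) / (2 * Real.pi)‖ = |c| / (2 * Real.pi) * N := fun N => by
      rw [norm_div, norm_neg, norm_mul, Real.norm_natCast, Real.norm_eq_abs,
        Real.norm_of_nonneg (by positivity)]
      ring
    simp only [h1]
    exact tendsto_natCast_atTop_atTop.const_mul_atTop (by positivity)
  refine ((Real.tendsto_integral_exp_smul_cocompact f).comp hw).congr fun N => ?_
  simp only [Function.comp_apply]
  congr 1
  funext v
  rw [Circle.smul_def, smul_eq_mul, Real.fourierChar_apply]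
  congr 2
  have : (Real.pi : ℂ) ≠ 0 := by exact_mod_cast Real.pi_ne_zero
  push_cast
  field_simp

/-- The Riemann–Lebesgue lemma along the frequencies `2 N`. -/
lemma tendsto_integral_mul_trig {f : ℝ → ℂ} {S : Set ℝ} (hS : MeasurableSet S)
    (hf : MeasureTheory.IntegrableOn f S) :
    Tendsto (fun N : ℕ => ∫ s in S, f s * Complex.cos (2 * N * s)) atTop (𝓝 0) ∧
    Tendsto (fun N : ℕ => ∫ s in S, f s * Complex.sin (2 * N * s)) atTop (𝓝 0) := by
  have key : ∀ c : ℝ, c ≠ 0 →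
      Tendsto (fun N : ℕ => ∫ s in S, Complex.exp (c * N * s * Complex.I) * f s) atTop (𝓝 0) :=
    fun c hc => by
    refine (tendsto_integral_exp_mul (f := S.indicator f) hc).congr fun N => ?_
    rw [← MeasureTheory.integral_indicator hS]
    congr 1
    funext s
    by_cases hs : s ∈ S <;> simp [hs]
  have hint : ∀ (c : ℝ) (N : ℕ), MeasureTheory.IntegrableOn
      (fun s : ℝ => Complex.exp (c * N * s * Complex.I) * f s) S := fun c N => by
    refine MeasureTheory.Integrable.bdd_mul (c := 1) hf
      (by fun_prop) (.of_forall fun s => le_of_eq ?_)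
    rw [show (c * N * s * Complex.I : ℂ) = ((c * N * s : ℝ) : ℂ) * Complex.I by push_cast; ring]
    exact Complex.norm_exp_ofReal_mul_I _
  have hp := key 2 two_ne_zero
  have hm := key (-2) (by norm_num)
  constructor
  · have := (hp.add hm).const_mul (1 / 2)
    rw [add_zero, mul_zero] at this
    refine this.congr fun N => ?_
    rw [← MeasureTheory.integral_add (hint 2 N) (hint (-2) N),
      ← MeasureTheory.integral_const_mul]
    refine MeasureTheory.integral_congr_ae (.of_forall fun s => ?_)
    simp only [Complex.cos]
    push_cast
    rw [show (-2 : ℂ) * N * s * Complex.I = -(2 * N * s) * Complex.I by ring]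
    ring
  · have := (hp.sub hm).const_mul (-Complex.I / 2)
    rw [sub_zero, mul_zero] at this
    refine this.congr fun N => ?_
    rw [← MeasureTheory.integral_sub (hint 2 N) (hint (-2) N),
      ← MeasureTheory.integral_const_mul]
    refine MeasureTheory.integral_congr_ae (.of_forall fun s => ?_)
    simp only [Complex.sin]
    push_cast
    rw [show (-2 : ℂ) * N * s * Complex.I = -(2 * N * s) * Complex.I by ring]
    ring

/-- The conjugate Dirichlet kernel: partial sums of `cot s = 2 ∑ sin (2 k s)`. -/
lemma cot_eq_sum_add {s : ℂ} (hs : Complex.sin s ≠ 0) (N : ℕ) :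
    Complex.cos s / Complex.sin s = ∑ k ∈ Finset.range N, 2 * Complex.sin (2 * (k + 1) * s)
      + (Complex.cos s / Complex.sin s * Complex.cos (2 * N * s) - Complex.sin (2 * N * s)) := by
  induction N with
  | zero => simp
  | succ N ih =>
    rw [Finset.sum_range_succ]
    refine ih.trans ?_
    push_cast
    rw [show 2 * ((N : ℂ) + 1) * s = 2 * N * s + 2 * s by ring, Complex.sin_add, Complex.cos_add,
      Complex.sin_two_mul, Complex.cos_two_mul]
    have h1 := Complex.sin_sq_add_cos_sq s
    generalize Complex.cos (2 * N * s) = a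
    generalize Complex.sin (2 * N * s) = b
    generalize ∑ k ∈ Finset.range N, 2 * Complex.sin (2 * (k + 1) * s) = c
    generalize Complex.sin s = σ at *
    generalize Complex.cos s = κ at *
    field_simp
    linear_combination (-2 * a * κ) * h1

/-- The sum of the two simple fractions with poles at `w = ±(k + 1)`. -/
noncomputable def poleTerm (w : ℂ) (k : ℕ) : ℂ :=
  1 / ((k : ℂ) + 1 + w) + 1 / ((k : ℂ) + 1 - w)

lemma integral_sin_mul_sin {y w : ℂ} {k : ℕ} (hp : (k : ℂ) + 1 + w ≠ 0) (hm : (k : ℂ) + 1 - w ≠ 0) :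
    ∫ s in (0 : ℝ)..(Real.pi / 2), 2 * Complex.sin (2 * (k + 1) * s)
      * Complex.sin (Real.pi * y - 2 * w * s)
      = 1 / 2 * poleTerm w k * (Complex.sin (Real.pi * y)
        + (-1) ^ k * Complex.sin (Real.pi * (y - w))) := by
  have hm' : w - ((k : ℂ) + 1) ≠ 0 := fun h => hm (by linear_combination -h)
  have hp' : w + ((k : ℂ) + 1) ≠ 0 := fun h => hp (by linear_combination h)
  have h : ∀ s : ℝ, HasDerivAt (fun s : ℝ =>
      -(1 / (2 * (w + (k + 1)))) * Complex.sin (Real.pi * y - 2 * (w + (k + 1)) * s)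
        + 1 / (2 * (w - (k + 1))) * Complex.sin (Real.pi * y - 2 * (w - (k + 1)) * s))
      (2 * Complex.sin (2 * (k + 1) * s) * Complex.sin (Real.pi * y - 2 * w * s)) s := fun s => by
    have h1 := (hasDerivAt_sin_lin (w + (k + 1)) (Real.pi * y) s).const_mul
      (-(1 / (2 * (w + (k + 1)))))
    have h2 := (hasDerivAt_sin_lin (w - (k + 1)) (Real.pi * y) s).const_mul
      (1 / (2 * (w - (k + 1))))
    convert! (h1.add h2).comp_ofReal using 1
    rw [show (Real.pi * y - 2 * (w + (k + 1)) * s : ℂ)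
        = (Real.pi * y - 2 * w * s) - 2 * (k + 1) * s by ring,
      show (Real.pi * y - 2 * (w - (k + 1)) * s : ℂ)
        = (Real.pi * y - 2 * w * s) + 2 * (k + 1) * s by ring, Complex.cos_sub, Complex.cos_add]
    field_simp
    ring
  rw [intervalIntegral.integral_eq_sub_of_hasDerivAt (fun s _ => h s)
      (Continuous.intervalIntegrable (by fun_prop) _ _)]
  have e1 : (Real.pi * y - 2 * (w + (k + 1)) * ((Real.pi / 2 : ℝ) : ℂ) : ℂ)
      = Real.pi * (y - w) - ((k + 1 : ℕ) : ℂ) * Real.pi := by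
    push_cast
    ring
  have e2 : (Real.pi * y - 2 * (w - (k + 1)) * ((Real.pi / 2 : ℝ) : ℂ) : ℂ)
      = Real.pi * (y - w) + ((k + 1 : ℕ) : ℂ) * Real.pi := by
    push_cast
    ring
  rw [e1, e2, Complex.sin_antiperiodic.sub_nat_mul_eq, Complex.sin_antiperiodic.add_nat_mul_eq,
    poleTerm, pow_succ,
    show 1 / ((k : ℂ) + 1 - w) = -(1 / (w - (k + 1))) by rw [← neg_sub w, div_neg],
    add_comm _ w]
  simp only [Complex.ofReal_zero, mul_zero, sub_zero]
  field_simp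
  ring

/-- The term of the partial fraction expansion of `∑ (x)ₙ (-x)ₙ / (n (1 + y)ₙ (1 - y)ₙ)`. -/
noncomputable def fracTerm (x y : ℂ) (k : ℕ) : ℂ :=
  1 / 2 * (poleTerm (x + y) k + poleTerm (x - y) k) - poleTerm y k
    - Complex.sin (Real.pi * x) / (2 * Complex.sin (Real.pi * y))
      * ((-1) ^ k * (poleTerm (x + y) k - poleTerm (x - y) k))

lemma poleTerm_neg (w : ℂ) (k : ℕ) : poleTerm (-w) k = poleTerm w k := by
  rw [poleTerm, poleTerm, sub_neg_eq_add, ← sub_eq_add_neg, add_comm]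

lemma natCast_add_one_add_ne_zero {w : ℂ} (hw : ∀ n : ℤ, n ≠ 0 → w ≠ n) (k : ℕ) :
    (k : ℂ) + 1 + w ≠ 0 := fun h =>
  hw (-(k + 1)) (by lia) (by push_cast; linear_combination h)

lemma natCast_add_one_sub_ne_zero {w : ℂ} (hw : ∀ n : ℤ, n ≠ 0 → w ≠ n) (k : ℕ) :
    (k : ℂ) + 1 - w ≠ 0 := fun h =>
  hw (k + 1) (by lia) (by push_cast; linear_combination -h)

/-- The term of the partial fraction expansion as an integral: `cos 2xs · sin (y (π - 2s))` is a half
sum of sines with frequencies `2 (y ± x)`. -/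
lemma integral_sin_mul_eq_fracTerm {x y : ℂ} (hy : ∀ n : ℤ, y ≠ n)
    (hp : ∀ n : ℤ, n ≠ 0 → x + y ≠ n) (hm : ∀ n : ℤ, n ≠ 0 → x - y ≠ n) (k : ℕ) :
    ∫ s in (0 : ℝ)..(Real.pi / 2), 2 * Complex.sin (2 * (k + 1) * s)
      * ((Complex.cos (2 * x * s) - 1) * Complex.sin (Real.pi * y - 2 * y * s))
      = Complex.sin (Real.pi * y) / 2 * fracTerm x y k := by
  have hm' : ∀ n : ℤ, n ≠ 0 → y - x ≠ n := fun n hn h =>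
    hm (-n) (neg_ne_zero.2 hn) (by push_cast; linear_combination -h)
  have hsin := sin_pi_mul_ne_zero_of_notInt hy
  have hc : ∀ w : ℂ, IntervalIntegrable (fun s : ℝ => 2 * Complex.sin (2 * (k + 1) * s)
      * Complex.sin (Real.pi * y - 2 * w * s)) MeasureTheory.volume 0 (Real.pi / 2) := fun w =>
    Continuous.intervalIntegrable (by fun_prop) _ _
  have hexp : ∀ s : ℝ, 2 * Complex.sin (2 * (k + 1) * s)
      * ((Complex.cos (2 * x * s) - 1) * Complex.sin (Real.pi * y - 2 * y * s))
      = 1 / 2 * (2 * Complex.sin (2 * (k + 1) * s) * Complex.sin (Real.pi * y - 2 * (y - x) * s))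
        + 1 / 2 * (2 * Complex.sin (2 * (k + 1) * s)
          * Complex.sin (Real.pi * y - 2 * (x + y) * s))
        - 2 * Complex.sin (2 * (k + 1) * s) * Complex.sin (Real.pi * y - 2 * y * s) := fun s => by
    rw [show (Real.pi * y - 2 * (y - x) * s : ℂ) = (Real.pi * y - 2 * y * s) + 2 * x * s by ring,
      show (Real.pi * y - 2 * (x + y) * s : ℂ) = (Real.pi * y - 2 * y * s) - 2 * x * s by ring]
    generalize (Real.pi * y - 2 * y * s : ℂ) = A
    rw [Complex.sin_add, Complex.sin_sub]
    ring
  simp only [hexp]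
  rw [intervalIntegral.integral_sub (((hc _).const_mul _).add ((hc _).const_mul _)) (hc _),
    intervalIntegral.integral_add ((hc _).const_mul _) ((hc _).const_mul _),
    intervalIntegral.integral_const_mul, intervalIntegral.integral_const_mul,
    integral_sin_mul_sin (natCast_add_one_add_ne_zero hm' k) (natCast_add_one_sub_ne_zero hm' k),
    integral_sin_mul_sin (natCast_add_one_add_ne_zero hp k) (natCast_add_one_sub_ne_zero hp k),
    integral_sin_mul_sin (natCast_add_one_add_ne_zero (fun n _ => hy n) k)
      (natCast_add_one_sub_ne_zero (fun n _ => hy n) k),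
    fracTerm, ← neg_sub x y, poleTerm_neg, sub_self, mul_zero, Complex.sin_zero,
    show (Real.pi * (y - -(x - y)) : ℂ) = Real.pi * x by ring,
    show (Real.pi * (y - (x + y)) : ℂ) = -(Real.pi * x) by ring, Complex.sin_neg]
  generalize Complex.sin (Real.pi * y) = σ at hsin ⊢
  generalize Complex.sin (Real.pi * x) = τ
  field_simp
  ring

/-- The partial fraction expansion: expand the cotangent in the integral formula. -/
lemma tendsto_sum_fracTerm {x y : ℂ} (hy : ∀ n : ℤ, y ≠ n)
    (hp : ∀ n : ℤ, n ≠ 0 → x + y ≠ n) (hm : ∀ n : ℤ, n ≠ 0 → x - y ≠ n) :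
    Tendsto (fun N => ∑ k ∈ Finset.range N, fracTerm x y k) atTop
      (𝓝 (∑' n, derivTerm x y n)) := by
  have hpi : (0 : ℝ) ≤ Real.pi / 2 := by positivity
  have hsin := sin_pi_mul_ne_zero_of_notInt hy
  let G : ℝ → ℂ := fun s => (Complex.cos (2 * x * s) - 1) * Complex.sin (Real.pi * y - 2 * y * s)
  have hGc : Continuous G := by fun_prop
  have hGi : MeasureTheory.IntegrableOn G (Set.Ioo 0 (Real.pi / 2)) :=
    hGc.integrableOn_Icc.mono_set Set.Ioo_subset_Icc_self
  have hgi := integrableOn_cotIntegrand x y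
  have hr := (tendsto_integral_mul_trig measurableSet_Ioo hgi).1.sub
    (tendsto_integral_mul_trig measurableSet_Ioo hGi).2
  rw [sub_zero] at hr
  have hI := (hasSum_integral_cotIntegrand (x := x) hy).tsum_eq
  rw [tsum_mul_left] at hI
  have hsplit : ∀ N : ℕ, Complex.sin (Real.pi * y) / 2 * ∑ k ∈ Finset.range N, fracTerm x y k
      = Complex.sin (Real.pi * y) / 2 * (∑' n, derivTerm x y n)
        - ((∫ s in Set.Ioo 0 (Real.pi / 2), cotIntegrand x y s * Complex.cos (2 * N * s))
          - ∫ s in Set.Ioo 0 (Real.pi / 2), G s * Complex.sin (2 * N * s)) := fun N => by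
    have hgN : MeasureTheory.IntegrableOn
        (fun s : ℝ => cotIntegrand x y s * Complex.cos (2 * N * s))
        (Set.Ioo 0 (Real.pi / 2)) := by
      refine MeasureTheory.Integrable.mul_bdd (c := 1) hgi (by fun_prop) (.of_forall fun s => ?_)
      have := norm_cos_ofReal_le (2 * N * s)
      push_cast at this
      exact this
    have hGN : MeasureTheory.IntegrableOn (fun s : ℝ => G s * Complex.sin (2 * N * s))
        (Set.Ioo 0 (Real.pi / 2)) :=
      (Continuous.integrableOn_Icc (by fun_prop)).mono_set Set.Ioo_subset_Icc_self
    have hdiff : MeasureTheory.IntegrableOn (fun s : ℝ =>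
        cotIntegrand x y s * Complex.cos (2 * N * s) - G s * Complex.sin (2 * N * s))
        (Set.Ioo 0 (Real.pi / 2)) := hgN.sub hGN
    rw [hI, Finset.mul_sum, ← MeasureTheory.integral_sub hgN hGN,
      intervalIntegral.integral_of_le hpi, MeasureTheory.integral_Ioc_eq_integral_Ioo,
      ← MeasureTheory.integral_sub hgi hdiff]
    simp only [← integral_sin_mul_eq_fracTerm hy hp hm]
    rw [← intervalIntegral.integral_finsetSum
      fun k _ => Continuous.intervalIntegrable (by fun_prop) _ _,
      intervalIntegral.integral_of_le hpi, MeasureTheory.integral_Ioc_eq_integral_Ioo]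
    refine MeasureTheory.setIntegral_congr_fun measurableSet_Ioo fun s hs => ?_
    have hs0 : Complex.sin s ≠ 0 := by
      rw [← Complex.ofReal_sin]
      exact_mod_cast (Real.sin_pos_of_pos_of_lt_pi hs.1 (by linarith [hs.2, Real.pi_pos])).ne'
    have hcot := cot_eq_sum_add hs0 N
    simp only [cotIntegrand, G]
    rw [← Finset.sum_mul]
    linear_combination -((Complex.cos (2 * x * s) - 1)
      * Complex.sin (Real.pi * y - 2 * y * s)) * hcot
  have h1 := (hr.const_sub (Complex.sin (Real.pi * y) / 2 * ∑' n, derivTerm x y n)).const_mul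
    (Complex.sin (Real.pi * y) / 2)⁻¹
  have h2 : Complex.sin (Real.pi * y) / 2 ≠ 0 := div_ne_zero hsin two_ne_zero
  rw [sub_zero, inv_mul_cancel_left₀ h2] at h1
  refine h1.congr fun N => ?_
  rw [← hsplit, inv_mul_cancel_left₀ h2]

/-! ### The digamma function as a limit of harmonic sums -/

/-- A pointwise convergent, uniformly bounded sequence of holomorphic functions may be
differentiated termwise, by Cauchy's formula and dominated convergence. -/
lemma tendsto_deriv_of_norm_le {U : Set ℂ} (hU : IsOpen U) {c : ℂ} {R M : ℝ} (hR : 0 < R)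
    (hc : Metric.closedBall c R ⊆ U) {F : ℕ → ℂ → ℂ} {f : ℂ → ℂ}
    (hF : ∀ n, DifferentiableOn ℂ (F n) U) (hf : DifferentiableOn ℂ f U)
    (hM : ∀ n, ∀ z ∈ Metric.sphere c R, ‖F n z‖ ≤ M)
    (hlim : ∀ z ∈ Metric.sphere c R, Tendsto (fun n => F n z) atTop (𝓝 (f z))) :
    Tendsto (fun n => deriv (F n) c) atTop (𝓝 (deriv f c)) := by
  have hc0 : c ∈ Metric.ball c R := Metric.mem_ball_self hR
  have hform : ∀ g : ℂ → ℂ, DifferentiableOn ℂ g U →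
      (2 * Real.pi * Complex.I : ℂ)⁻¹ • (∮ z in C(c, R), ((z - c) ^ 2)⁻¹ • g z) = deriv g c :=
    fun g hg => Complex.two_pi_I_inv_smul_circleIntegral_sub_sq_inv_smul_of_differentiable
      hU hc hg hc0
  rw [← hform f hf]
  simp only [← hform _ (hF _)]
  refine Tendsto.const_smul ?_ _
  have hmem : ∀ θ, circleMap c R θ ∈ Metric.sphere c R := circleMap_mem_sphere c hR.le
  have hci : ∀ n, CircleIntegrable (fun z => ((z - c) ^ 2)⁻¹ • F n z) c R := fun n => by
    have hc2 : ContinuousOn (fun z : ℂ => (z - c) ^ 2) (Metric.sphere c R) := by fun_prop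
    refine ContinuousOn.circleIntegrable hR.le (ContinuousOn.smul (hc2.inv₀
      fun z hz h => ?_) ((hF n).continuousOn.mono (Metric.sphere_subset_closedBall.trans hc)))
    rw [mem_sphere_iff_norm, pow_eq_zero_iff two_ne_zero |>.1 h, norm_zero] at hz
    exact hR.ne hz
  refine intervalIntegral.tendsto_integral_filter_of_dominated_convergence
    (fun _ => R * ((R ^ 2)⁻¹ * M)) (.of_forall fun n => ?_) (.of_forall fun n => .of_forall
    fun θ _ => ?_) (by simp) (.of_forall fun θ _ => ?_)
  · exact (hci n).out.aestronglyMeasurable_restrict_uIoc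
  · have h1 : ‖circleMap c R θ - c‖ = R := mem_sphere_iff_norm.1 (hmem θ)
    rw [norm_smul, norm_smul, norm_inv, norm_pow, h1, deriv_circleMap, norm_mul, Complex.norm_I,
      mul_one, norm_circleMap_zero, abs_of_pos hR]
    gcongr
    exact hM n _ (hmem θ)
  · exact ((hlim _ (hmem θ)).const_smul _).const_smul _

/-- Euler's sequence for `Γ` is bounded on vertical strips in the right half plane. -/
lemma exists_norm_GammaSeq_le {a b : ℝ} (ha : 0 < a) (hb : 0 < b) :
    ∃ M, ∀ n : ℕ, ∀ z : ℂ, a ≤ z.re → z.re ≤ b → ‖Complex.GammaSeq z (n + 1)‖ ≤ M := by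
  let h : ℝ → ℝ := fun t => Real.exp (-t) * t ^ (a - 1) + Real.exp (-t) * t ^ (b - 1)
  have hi : MeasureTheory.IntegrableOn h (Set.Ioi 0) :=
    (Real.GammaIntegral_convergent ha).add (Real.GammaIntegral_convergent hb)
  refine ⟨∫ t in Set.Ioi 0, h t, fun n z hza hzb => ?_⟩
  have hn : (0 : ℝ) ≤ ((n + 1 : ℕ) : ℝ) := Nat.cast_nonneg _
  rw [Complex.GammaSeq_eq_approx_Gamma_integral (ha.trans_le hza) n.succ_ne_zero,
    intervalIntegral.integral_of_le hn]
  have hsub : Set.Ioc 0 ((n + 1 : ℕ) : ℝ) ⊆ Set.Ioi 0 := Set.Ioc_subset_Ioi_self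
  have hnonneg : ∀ t ∈ Set.Ioi (0 : ℝ), 0 ≤ h t := fun t ht => by
    have : (0 : ℝ) < t := ht
    positivity
  refine (MeasureTheory.norm_integral_le_of_norm_le (hi.mono_set hsub) ?_).trans
    (MeasureTheory.setIntegral_mono_set hi
      ((MeasureTheory.ae_restrict_iff' measurableSet_Ioi).2 (.of_forall hnonneg))
      (.of_forall hsub))
  refine (MeasureTheory.ae_restrict_iff' measurableSet_Ioc).2 (.of_forall fun t ht => ?_)
  have ht0 : 0 < t := ht.1
  have hfac : 0 ≤ 1 - t / ((n + 1 : ℕ) : ℝ) := by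
    rw [sub_nonneg, div_le_one (by positivity)]
    exact ht.2
  rw [norm_mul, Complex.norm_real, Real.norm_of_nonneg (pow_nonneg hfac _),
    Complex.norm_cpow_eq_rpow_re_of_pos ht0, Complex.sub_re, Complex.one_re]
  have hpow : t ^ (z.re - 1) ≤ t ^ (a - 1) + t ^ (b - 1) := by
    have pa : 0 < t ^ (a - 1) := Real.rpow_pos_of_pos ht0 _
    have pb : 0 < t ^ (b - 1) := Real.rpow_pos_of_pos ht0 _
    rcases le_total t 1 with h1 | h1
    · have := Real.rpow_le_rpow_of_exponent_ge ht0 h1 (by linarith : a - 1 ≤ z.re - 1)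
      linarith
    · have := Real.rpow_le_rpow_of_exponent_le h1 (by linarith : z.re - 1 ≤ b - 1)
      linarith
  calc _ ≤ Real.exp (-t) * (t ^ (a - 1) + t ^ (b - 1)) := by
        gcongr
        exact Real.one_sub_div_pow_le_exp_neg ht.2
    _ = h t := mul_add _ _ _

lemma hasDerivAt_prod_add {s : ℂ} (hs : ∀ j : ℕ, s + j ≠ 0) (n : ℕ) :
    HasDerivAt (fun s : ℂ => ∏ j ∈ Finset.range n, (s + j))
      ((∏ j ∈ Finset.range n, (s + j)) * ∑ j ∈ Finset.range n, 1 / (s + j)) s := by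
  induction n with
  | zero => simpa using hasDerivAt_const s (1 : ℂ)
  | succ n ih =>
    simp only [Finset.prod_range_succ, Finset.sum_range_succ]
    convert! ih.mul ((hasDerivAt_id s).add_const (n : ℂ)) using 1
    have := hs n
    simp only [id]
    field_simp

/-- The logarithmic derivative of Euler's sequence `n ^ s * n! / (s (s + 1) ⋯ (s + n))`. -/
lemma hasDerivAt_GammaSeq {s : ℂ} (hs : ∀ j : ℕ, s + j ≠ 0) {n : ℕ} (hn : n ≠ 0) :
    HasDerivAt (fun s => Complex.GammaSeq s n) (Complex.GammaSeq s n
      * (Complex.log n - ∑ j ∈ Finset.range (n + 1), 1 / (s + j))) s := by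
  have hn' : (n : ℂ) ≠ 0 := Nat.cast_ne_zero.2 hn
  have hP : ∏ j ∈ Finset.range (n + 1), (s + (j : ℂ)) ≠ 0 :=
    Finset.prod_ne_zero_iff.2 fun j _ => hs j
  have h1 := (((hasDerivAt_id s).const_cpow (c := (n : ℂ)) (.inl hn')).mul_const
    (n.factorial : ℂ)).div (hasDerivAt_prod_add hs (n + 1)) hP
  simp only [Complex.GammaSeq]
  convert! h1 using 1
  simp only [id]
  field_simp

lemma add_natCast_ne_zero_of_re_pos {s : ℂ} (hs : 0 < s.re) (j : ℕ) : s + j ≠ 0 := fun h => by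
  have := congrArg Complex.re h
  simp only [Complex.add_re, Complex.natCast_re, Complex.zero_re] at this
  have hj : (0 : ℝ) ≤ j := Nat.cast_nonneg j
  linarith

lemma tendsto_one_div_add_natCast (s : ℂ) :
    Tendsto (fun n : ℕ => 1 / (s + n)) atTop (𝓝 0) := by
  simp only [one_div]
  refine tendsto_inv₀_cobounded.comp ?_
  rw [← tendsto_norm_atTop_iff_cobounded]
  refine tendsto_atTop_mono (fun n : ℕ => ?_)
    (tendsto_natCast_atTop_atTop.atTop_add (tendsto_const_nhds (x := -‖s‖)))
  have := norm_sub_norm_le (n : ℂ) (-s)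
  rw [norm_neg, Complex.norm_natCast, sub_neg_eq_add, add_comm (n : ℂ)] at this
  linarith

/-- In the right half plane, differentiate the limit of Euler's sequence. -/
lemma tendsto_log_sub_sum_of_re_pos {s : ℂ} (hs : 0 < s.re) :
    Tendsto (fun n : ℕ => Complex.log n - ∑ j ∈ Finset.range n, 1 / (s + j)) atTop
      (𝓝 (Complex.digamma s)) := by
  let U : Set ℂ := {z | 0 < z.re}
  have hU : IsOpen U := isOpen_lt continuous_const Complex.continuous_re
  have hre : ∀ z ∈ Metric.closedBall s (s.re / 2), s.re / 2 ≤ z.re ∧ z.re ≤ 3 * s.re / 2 :=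
    fun z hz => by
    have := (Complex.abs_re_le_norm (z - s)).trans (mem_closedBall_iff_norm.1 hz)
    rw [Complex.sub_re, abs_le] at this
    constructor <;> linarith [this.1, this.2]
  obtain ⟨M, hM⟩ := exists_norm_GammaSeq_le (a := s.re / 2) (b := 3 * s.re / 2)
    (by linarith) (by linarith)
  have hd := tendsto_deriv_of_norm_le hU (c := s) (R := s.re / 2) (M := M) (by linarith)
    (F := fun n z => Complex.GammaSeq z (n + 1)) (f := Complex.Gamma)
    (fun z hz => show 0 < z.re by linarith [(hre z hz).1])
    (fun n z hz => (hasDerivAt_GammaSeq (add_natCast_ne_zero_of_re_pos hz)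
      n.succ_ne_zero).differentiableAt.differentiableWithinAt)
    (fun z hz => (Complex.differentiableAt_Gamma z fun m h =>
      add_natCast_ne_zero_of_re_pos hz m (by rw [h]; ring)).differentiableWithinAt)
    (fun n z hz => hM n z (hre z (Metric.sphere_subset_closedBall hz)).1
      (hre z (Metric.sphere_subset_closedBall hz)).2)
    (fun z _ => (Complex.GammaSeq_tendsto_Gamma z).comp (tendsto_add_atTop_nat 1))
  have hG : Complex.Gamma s ≠ 0 := Complex.Gamma_ne_zero_of_re_pos hs
  have hGs := (Complex.GammaSeq_tendsto_Gamma s).comp (tendsto_add_atTop_nat 1)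
  have h1 := (hd.div hGs hG).add ((tendsto_one_div_add_natCast s).comp (tendsto_add_atTop_nat 1))
  rw [add_zero] at h1
  rw [← tendsto_add_atTop_iff_nat 1, Complex.digamma_def, logDeriv_apply]
  refine h1.congr' ?_
  filter_upwards [hGs.eventually_ne hG] with n hn
  simp only [Function.comp_apply, Pi.div_apply] at hn ⊢
  rw [(hasDerivAt_GammaSeq (add_natCast_ne_zero_of_re_pos hs) n.succ_ne_zero).deriv,
    mul_div_cancel_left₀ _ hn, Finset.sum_range_succ]
  ring

/-- `ψ(s) = lim (log n - ∑_{j < n} 1 / (s + j))`, off the poles of `ψ`. -/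
lemma tendsto_log_sub_sum {s : ℂ} (hs : ∀ j : ℕ, s + j ≠ 0) :
    Tendsto (fun n : ℕ => Complex.log n - ∑ j ∈ Finset.range n, 1 / (s + j)) atTop
      (𝓝 (Complex.digamma s)) := by
  -- reduce to the right half plane by `ψ(s + 1) = ψ(s) + 1 / s`
  obtain ⟨m, hm⟩ := exists_nat_gt (-s.re)
  induction m generalizing s with
  | zero => exact tendsto_log_sub_sum_of_re_pos (by simpa using hm)
  | succ m ih =>
    have hs' : ∀ j : ℕ, s + 1 + j ≠ 0 := fun j h => hs (j + 1) (by push_cast; rw [← h]; ring)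
    have h1 := ih hs' (by
      rw [Complex.add_re, Complex.one_re]
      push_cast at hm
      linarith)
    have h0 : s ≠ 0 := by simpa using hs 0
    rw [Complex.digamma_apply_add_one s fun m h => hs m (by rw [h]; ring)] at h1
    have h2 := (h1.sub_const s⁻¹).add (tendsto_one_div_add_natCast s)
    rw [add_sub_cancel_right, add_zero] at h2
    refine h2.congr fun n => ?_
    have h3 := Finset.sum_range_succ (fun j : ℕ => 1 / (s + j)) n
    rw [Finset.sum_range_succ'] at h3
    have h4 : ∑ j ∈ Finset.range n, 1 / (s + ((j + 1 : ℕ) : ℂ))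
        = ∑ j ∈ Finset.range n, 1 / (s + 1 + j) :=
      Finset.sum_congr rfl fun j _ => by push_cast; rw [add_assoc, add_comm (1 : ℂ)]
    rw [h4, Nat.cast_zero, add_zero] at h3
    linear_combination -h3 - (one_div s)

/-! ### Evaluation of the derivative by digamma values -/

lemma tendsto_sum_poleTerm {w : ℂ} (hw : ∀ n : ℤ, n ≠ 0 → w ≠ n) :
    Tendsto (fun N : ℕ => ∑ k ∈ Finset.range N, poleTerm w k - 2 * Complex.log N) atTop
      (𝓝 (-(Complex.digamma (1 + w) + Complex.digamma (1 - w)))) := by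
  have h1 := tendsto_log_sub_sum (s := 1 + w) fun j h =>
    natCast_add_one_add_ne_zero hw j (by rw [← h]; ring)
  have h2 := tendsto_log_sub_sum (s := 1 - w) fun j h =>
    natCast_add_one_sub_ne_zero hw j (by rw [← h]; ring)
  refine (h1.add h2).neg.congr fun N => ?_
  have e1 : ∀ k : ℕ, 1 + w + (k : ℂ) = k + 1 + w := fun k => by ring
  have e2 : ∀ k : ℕ, 1 - w + (k : ℂ) = k + 1 - w := fun k => by ring
  simp only [poleTerm, Finset.sum_add_distrib, e1, e2]
  ring

/-- The terms of odd index for `w` are half the terms for `w / 2`, which removes the sign `(-1) ^ k`. -/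
lemma sum_alternating_poleTerm (w : ℂ) (N : ℕ) :
    ∑ k ∈ Finset.range (2 * N), (-1) ^ k * poleTerm w k
      = ∑ k ∈ Finset.range (2 * N), poleTerm w k - ∑ k ∈ Finset.range N, poleTerm (w / 2) k := by
  induction N with
  | zero => simp
  | succ N ih =>
    have h : poleTerm (w / 2) N = 2 * poleTerm w (2 * N + 1) := by
      rw [poleTerm, poleTerm]
      push_cast
      rw [show (N : ℂ) + 1 + w / 2 = (2 * N + 1 + 1 + w) / 2 by ring,
        show (N : ℂ) + 1 - w / 2 = (2 * N + 1 + 1 - w) / 2 by ring, one_div_div, one_div_div]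
      ring
    rw [show 2 * (N + 1) = 2 * N + 1 + 1 by ring, Finset.sum_range_succ, Finset.sum_range_succ,
      Finset.sum_range_succ (poleTerm w), Finset.sum_range_succ (poleTerm w),
      Finset.sum_range_succ (poleTerm (w / 2)), ih, h, pow_succ, pow_mul]
    ring

/-- Zagier's evaluation of the `z`-derivative at `0` of `₃F₂(x, -x, z; 1 + y, 1 - y; 1)`. -/
lemma tsum_derivTerm_eq_zagierPsi {x y : ℂ} (hy : ∀ n : ℤ, y ≠ n)
    (hp : ∀ n : ℤ, n ≠ 0 → x + y ≠ n) (hm : ∀ n : ℤ, n ≠ 0 → x - y ≠ n) :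
    ∑' n, derivTerm x y n = zagierPsi x y := by
  have h2N : Tendsto (fun N : ℕ => 2 * N) atTop atTop :=
    tendsto_id.const_mul_atTop' two_pos
  have half : ∀ {w : ℂ}, (∀ n : ℤ, n ≠ 0 → w ≠ n) → ∀ n : ℤ, n ≠ 0 → w / 2 ≠ n :=
    fun {w} hw n hn h => hw (2 * n) (by lia) (by push_cast; rw [← h]; ring)
  -- along `2 N` all the logarithms cancel, the two `log 2` included
  have hA := (tendsto_sum_poleTerm hp).comp h2N
  have hB := (tendsto_sum_poleTerm hm).comp h2N
  have hC := (tendsto_sum_poleTerm fun n _ => hy n).comp h2N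
  have hA' := tendsto_sum_poleTerm (half hp)
  have hB' := tendsto_sum_poleTerm (half hm)
  have hlim := (((hA.add hB).const_mul (1 / 2)).sub hC).sub
    (((hA.sub hA').sub (hB.sub hB')).const_mul
      (Complex.sin (Real.pi * x) / (2 * Complex.sin (Real.pi * y))))
  refine (tendsto_nhds_unique ((tendsto_sum_fracTerm hy hp hm).comp h2N)
    (hlim.congr fun N => ?_)).trans ?_
  · simp only [Function.comp_apply, fracTerm, Finset.sum_sub_distrib, ← Finset.mul_sum,
      Finset.sum_add_distrib, mul_sub, sum_alternating_poleTerm]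
    ring
  · rw [zagierPsi, show 1 + (x + y) = 1 + x + y by ring, show 1 - (x + y) = 1 - x - y by ring,
      show 1 + (x - y) = 1 + x - y by ring, show 1 - (x - y) = 1 - x + y by ring]
    ring

/-! ### Expansion near the origin -/

lemma hasSum_sum_antidiagonal_snd {f : ℕ × ℕ × ℕ → ℂ} {t : ℂ} (h : HasSum f t) :
    HasSum (fun p : ℕ × ℕ => ∑ q ∈ Finset.HasAntidiagonal.antidiagonal p.2, f (p.1, q)) t := by
  let e : (Σ p : ℕ × ℕ, Finset.HasAntidiagonal.antidiagonal p.2) ≃ ℕ × ℕ × ℕ :=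
    { toFun := fun p => (p.1.1, p.2.1)
      invFun := fun q => ⟨(q.1, q.2.1 + q.2.2), ⟨q.2, by simp⟩⟩
      left_inv := by
        rintro ⟨⟨a, b⟩, ⟨q, hq⟩⟩
        have hb := Finset.HasAntidiagonal.mem_antidiagonal.1 hq
        subst hb
        rfl
      right_inv := fun q => rfl }
  refine ((e.hasSum_iff (f := f)).2 h).sigma fun p => ?_
  rw [← Finset.sum_coe_sort]
  exact hasSum_fintype _

lemma hasSum_sum_antidiagonal {f : ℕ × ℕ → ℂ} {t : ℂ} (h : HasSum f t) :
    HasSum (fun n : ℕ => ∑ q ∈ Finset.HasAntidiagonal.antidiagonal n, f q) t := by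
  refine ((Finset.HasAntidiagonal.sigmaAntidiagonalEquivProd.hasSum_iff (f := f)).2 h).sigma
    fun p => ?_
  rw [← Finset.sum_coe_sort]
  exact hasSum_fintype _

lemma sum_range_two_mul_add_one (f : ℕ → ℂ) (M : ℕ) : ∑ i ∈ Finset.range (2 * M + 1), f i
    = f 0 + ∑ j ∈ Finset.range M, f (2 * j + 2) + ∑ j ∈ Finset.range M, f (2 * j + 1) := by
  induction M with
  | zero => simp
  | succ M ih =>
    rw [show 2 * (M + 1) + 1 = 2 * M + 1 + 1 + 1 by ring, Finset.sum_range_succ,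
      Finset.sum_range_succ, ih, Finset.sum_range_succ, Finset.sum_range_succ]
    ring

/-- The binomial expansion of an even power, split by the parity of the exponent of `x`. -/
lemma add_pow_even (x y : ℂ) (m : ℕ) : (x + y) ^ (2 * m + 2) = y ^ (2 * m + 2)
    + ∑ q ∈ Finset.HasAntidiagonal.antidiagonal m,
      ((2 * m + 2).choose (2 * q.1 + 2) : ℂ) * (x ^ (2 * q.1 + 2) * y ^ (2 * q.2))
    + ∑ q ∈ Finset.HasAntidiagonal.antidiagonal m,
      ((2 * m + 2).choose (2 * q.1 + 1) : ℂ) * (x ^ (2 * q.1 + 1) * y ^ (2 * q.2 + 1)) := by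
  rw [add_pow, show 2 * m + 2 + 1 = 2 * (m + 1) + 1 by ring, sum_range_two_mul_add_one,
    Finset.Nat.sum_antidiagonal_eq_sum_range_succ_mk,
    Finset.Nat.sum_antidiagonal_eq_sum_range_succ_mk]
  congr 1
  · congr 1
    · simp
    · refine Finset.sum_congr rfl fun j hj => ?_
      rw [Finset.mem_range] at hj
      rw [show 2 * m + 2 - (2 * j + 2) = 2 * (m - j) by lia]
      ring
  · refine Finset.sum_congr rfl fun j hj => ?_
    rw [Finset.mem_range] at hj
    rw [show 2 * m + 2 - (2 * j + 1) = 2 * (m - j) + 1 by lia]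
    ring

lemma neg_pow_two_mul (y : ℂ) (n : ℕ) : (-y) ^ (2 * n) = y ^ (2 * n) := by
  rw [pow_mul, neg_sq, ← pow_mul]

lemma neg_pow_two_mul_add_one (y : ℂ) (n : ℕ) : (-y) ^ (2 * n + 1) = -y ^ (2 * n + 1) := by
  rw [pow_succ, neg_pow_two_mul, mul_neg, pow_succ]

lemma neg_pow_two_mul_add_two (y : ℂ) (n : ℕ) : (-y) ^ (2 * n + 2) = y ^ (2 * n + 2) :=
  neg_pow_two_mul y (n + 1)

lemma add_pow_add_sub_pow (x y : ℂ) (m : ℕ) :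
    (x + y) ^ (2 * m + 2) + (x - y) ^ (2 * m + 2) - 2 * y ^ (2 * m + 2)
      = ∑ q ∈ Finset.HasAntidiagonal.antidiagonal m, 2 * ((2 * m + 2).choose (2 * q.1 + 2) : ℂ)
        * (x ^ (2 * q.1 + 2) * y ^ (2 * q.2)) := by
  have h2 := add_pow_even x (-y) m
  simp only [neg_pow_two_mul, neg_pow_two_mul_add_one, neg_pow_two_mul_add_two, mul_neg,
    Finset.sum_neg_distrib, ← sub_eq_add_neg] at h2
  rw [add_pow_even x y, h2]
  simp only [mul_assoc, ← Finset.mul_sum]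
  ring

lemma add_pow_sub_sub_pow (x y : ℂ) (m : ℕ) :
    (x + y) ^ (2 * m + 2) - (x - y) ^ (2 * m + 2)
      = ∑ q ∈ Finset.HasAntidiagonal.antidiagonal m, 2 * ((2 * m + 2).choose (2 * q.1 + 1) : ℂ)
        * (y ^ (2 * q.1 + 1) * x ^ (2 * q.2 + 1)) := by
  have h2 := add_pow_even (-y) x m
  simp only [neg_pow_two_mul_add_one, neg_pow_two_mul_add_two, mul_neg, neg_mul,
    Finset.sum_neg_distrib] at h2
  rw [add_comm x, add_pow_even y x, sub_eq_neg_add x, h2]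
  simp only [mul_assoc, ← Finset.mul_sum]
  ring

/-- The value `ζ(s) = ∑ 1 / (k + 1)^s` as a complex number. -/
noncomputable def zetaSum (s : ℕ) : ℂ := ∑' k : ℕ, 1 / ((k : ℂ) + 1) ^ s

lemma summable_zetaSum {s : ℕ} (hs : 1 < s) : Summable fun k : ℕ => 1 / ((k : ℝ) + 1) ^ s := by
  simpa using (summable_nat_add_iff 1).2 (Real.summable_one_div_nat_pow.2 hs)

lemma norm_natCast_add_one (k : ℕ) : ‖(k : ℂ) + 1‖ = k + 1 := by
  rw [← Nat.cast_succ, Complex.norm_natCast, Nat.cast_succ]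

lemma hasSum_zetaSum {s : ℕ} (hs : 1 < s) :
    HasSum (fun k : ℕ => 1 / ((k : ℂ) + 1) ^ s) (zetaSum s) := by
  refine Summable.hasSum (.of_norm ?_)
  refine (summable_zetaSum hs).congr fun k => ?_
  rw [norm_div, norm_pow, norm_natCast_add_one, norm_one]

/-- One-entry indices are the positive integers. -/
def mzvIndexOneEquiv : ℕ ≃ MZVIndex 1 where
  toFun k := ⟨fun _ => k + 1, fun _ => k.succ_pos, Subsingleton.strictMono _⟩
  invFun m := m.1 0 - 1
  left_inv k := rfl
  right_inv m := by
    refine Subtype.ext (funext fun i => ?_)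
    rw [Subsingleton.elim i 0]
    exact Nat.sub_add_cancel (m.2.1 0)

lemma mzvTerm_single_equiv (s k : ℕ) :
    mzvTerm (single s) (mzvIndexOneEquiv k) = 1 / ((k : ℝ) + 1) ^ s := by
  change 1 / ∏ i : Fin 1, ((k + 1 : ℕ) : ℝ) ^ s = _
  simp

lemma summable_mzvTerm_single {s : ℕ} (hs : 1 < s) : Summable (mzvTerm (single s)) := by
  rw [← mzvIndexOneEquiv.summable_iff]
  exact (summable_zetaSum hs).congr fun k => (mzvTerm_single_equiv s k).symm

lemma mzv_single (s : ℕ) : (mzv (single s) : ℂ) = zetaSum s := by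
  rw [mzv, ← mzvIndexOneEquiv.tsum_eq, Complex.ofReal_tsum, zetaSum]
  refine tsum_congr fun k => ?_
  rw [mzvTerm_single_equiv]
  push_cast
  rfl

lemma hasSum_alternating {f : ℕ → ℂ} {z o : ℂ} (hf : HasSum f z)
    (ho : HasSum (fun k => f (2 * k + 1)) o) : HasSum (fun k => (-1) ^ k * f k) (z - 2 * o) := by
  have he : Summable fun k => f (2 * k) :=
    hf.summable.comp_injective (mul_right_injective₀ (two_ne_zero' ℕ))
  have htot : ∑' k, f (2 * k) + o = z := (he.hasSum.even_add_odd ho).unique hf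
  have h1 : HasSum (fun k => (-1) ^ (2 * k) * f (2 * k)) (∑' k, f (2 * k)) := by
    simpa [pow_mul] using he.hasSum
  have h2 : HasSum (fun k => (-1) ^ (2 * k + 1) * f (2 * k + 1)) (-o) := by
    simpa [pow_mul, pow_succ] using ho.neg
  have h3 := HasSum.even_add_odd (f := fun k => (-1) ^ k * f k) h1 h2
  rwa [show ∑' k, f (2 * k) + -o = z - 2 * o by rw [← htot]; ring] at h3

lemma hasSum_alternating_zetaSum {s : ℕ} (hs : 1 < s) :
    HasSum (fun k : ℕ => (-1) ^ k * (1 / ((k : ℂ) + 1) ^ s)) ((1 - 2 / 2 ^ s) * zetaSum s) := by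
  have ho : HasSum (fun k : ℕ => 1 / (((2 * k + 1 : ℕ) : ℂ) + 1) ^ s) (zetaSum s / 2 ^ s) := by
    refine ((hasSum_zetaSum hs).div_const (2 ^ s)).congr_fun fun k => ?_
    rw [show (((2 * k + 1 : ℕ) : ℂ) + 1) = (k + 1) * 2 by push_cast; ring, mul_pow, div_div]
  have h := hasSum_alternating (hasSum_zetaSum hs) ho
  rwa [show zetaSum s - 2 * (zetaSum s / 2 ^ s) = (1 - 2 / 2 ^ s) * zetaSum s by ring] at h

lemma hasSum_poleTerm_sub {w : ℂ} (hw : ‖w‖ < 1) (k : ℕ) :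
    HasSum (fun m : ℕ => 2 * w ^ (2 * m + 2) * (1 / ((k : ℂ) + 1) ^ (2 * m + 3)))
      (poleTerm w k - 2 / (k + 1)) := by
  have hK : (k : ℂ) + 1 ≠ 0 := Nat.cast_add_one_ne_zero k
  have hlt : ‖w‖ < (k : ℝ) + 1 := hw.trans_le (by simp)
  have hp : (k : ℂ) + 1 + w ≠ 0 := fun h => by
    rw [eq_neg_of_add_eq_zero_right h, norm_neg, norm_natCast_add_one] at hlt
    exact lt_irrefl _ hlt
  have hm : (k : ℂ) + 1 - w ≠ 0 := fun h => by
    rw [← sub_eq_zero.1 h, norm_natCast_add_one] at hlt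
    exact lt_irrefl _ hlt
  have hr : ‖w ^ 2 / ((k : ℂ) + 1) ^ 2‖ < 1 := by
    rw [norm_div, norm_pow, norm_pow, norm_natCast_add_one, div_lt_one (by positivity)]
    exact pow_lt_pow_left₀ hlt (norm_nonneg _) two_ne_zero
  have h := (hasSum_geometric_of_norm_lt_one hr).mul_left (2 * w ^ 2 / ((k : ℂ) + 1) ^ 3)
  have hne : ((k : ℂ) + 1) ^ 2 - w ^ 2 ≠ 0 := by
    rw [sq_sub_sq]
    exact mul_ne_zero hp hm
  convert! h using 1
  · funext m
    rw [div_pow, ← pow_mul, ← pow_mul, pow_add, pow_add ((k : ℂ) + 1)]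
    field_simp
  · rw [poleTerm, one_sub_div (pow_ne_zero 2 hK)]
    field_simp
    ring

/-- Rearrangement of `∑ₖ εₖ (poleTerm w k - 2 / (k + 1))` into a power series in `w`. -/
lemma hasSum_mul_poleTerm_sub {w : ℂ} (hw : ‖w‖ < 1) {ε : ℕ → ℂ} (hε : ∀ k, ‖ε k‖ ≤ 1) {Z : ℕ → ℂ}
    (hZ : ∀ m, HasSum (fun k : ℕ => ε k * (1 / ((k : ℂ) + 1) ^ (2 * m + 3))) (Z m)) :
    ∃ T, HasSum (fun k => ε k * (poleTerm w k - 2 / (k + 1))) T ∧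
      HasSum (fun m => 2 * w ^ (2 * m + 2) * Z m) T := by
  let f : ℕ × ℕ → ℂ := fun p =>
    ε p.1 * (2 * w ^ (2 * p.2 + 2) * (1 / ((p.1 : ℂ) + 1) ^ (2 * p.2 + 3)))
  have hg : Summable fun m : ℕ => 2 * ‖w‖ ^ (2 * m + 2) := by
    have h1 : ‖w‖ ^ 2 < 1 := by nlinarith [norm_nonneg w]
    refine ((summable_geometric_of_lt_one (sq_nonneg _) h1).mul_left (2 * ‖w‖ ^ 2)).congr
      fun m => ?_
    rw [← pow_mul]
    ring
  have hf : Summable f := by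
    refine ((summable_zetaSum (s := 3) (by norm_num)).mul_of_nonneg hg (fun k => by positivity)
      fun m => by positivity).of_norm_bounded fun p => ?_
    simp only [f]
    rw [norm_mul, norm_mul, norm_mul, norm_pow, norm_div, norm_one, norm_pow,
      norm_natCast_add_one, Complex.norm_ofNat]
    calc _ ≤ 1 * (2 * ‖w‖ ^ (2 * p.2 + 2) * (1 / ((p.1 : ℝ) + 1) ^ 3)) := by
          gcongr
          · exact hε _
          · simp
          · lia
      _ = _ := by ring
  refine ⟨_, hf.hasSum.prod_fiberwise fun k => (hasSum_poleTerm_sub hw k).mul_left _, ?_⟩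
  refine HasSum.prod_fiberwise (f := fun p : ℕ × ℕ => f p.swap)
    ((Equiv.prodComm ℕ ℕ).hasSum_iff.2 hf.hasSum) fun m => ?_
  refine ((hZ m).mul_left (2 * w ^ (2 * m + 2))).congr_fun fun k => ?_
  simp only [f, Prod.swap]
  ring

/-- The series of simple fractions near the origin, as two power series in `x` and `y` with zeta
values as coefficients. -/
lemma exists_hasSum_zagierF {x y : ℂ} (hy0 : y ≠ 0) (hx : ‖x‖ < 1 / 2) (hy : ‖y‖ < 1 / 2) :
    ∃ U V, Real.pi * zagierF x y
        = Complex.sin (Real.pi * y) * U - Complex.sin (Real.pi * x) * V ∧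
      HasSum (fun m : ℕ => zetaSum (2 * m + 3)
        * ((x + y) ^ (2 * m + 2) + (x - y) ^ (2 * m + 2) - 2 * y ^ (2 * m + 2))) U ∧
      HasSum (fun m : ℕ => (1 - 2 / 2 ^ (2 * m + 3)) * zetaSum (2 * m + 3)
        * ((x + y) ^ (2 * m + 2) - (x - y) ^ (2 * m + 2))) V := by
  have hnorm : ∀ {w : ℂ} {n : ℤ}, ‖w‖ < 1 → w = n → n = 0 := fun {w n} hw h => by
    rw [h, Complex.norm_intCast] at hw
    exact Int.abs_lt_one_iff.1 (by exact_mod_cast hw)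
  have hp : ‖x + y‖ < 1 := (norm_add_le x y).trans_lt (by linarith)
  have hm : ‖x - y‖ < 1 := (norm_sub_le x y).trans_lt (by linarith)
  have hy1 : ‖y‖ < 1 := by linarith
  have hyZ : ∀ n : ℤ, y ≠ n := fun n h => hy0 (by rw [h, hnorm hy1 h, Int.cast_zero])
  have hone : ∀ k : ℕ, ‖(1 : ℂ)‖ ≤ 1 := fun _ => by simp
  have halt : ∀ k : ℕ, ‖((-1 : ℂ)) ^ k‖ ≤ 1 := fun k => by simp
  have hZ : ∀ m : ℕ, HasSum (fun k : ℕ => (1 : ℂ) * (1 / ((k : ℂ) + 1) ^ (2 * m + 3)))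
      (zetaSum (2 * m + 3)) := fun m => by
    simpa only [one_mul] using hasSum_zetaSum (s := 2 * m + 3) (by lia)
  have hZ' := fun m : ℕ => hasSum_alternating_zetaSum (s := 2 * m + 3) (by lia)
  obtain ⟨Tp, hTp, hTp'⟩ := hasSum_mul_poleTerm_sub hp hone hZ
  obtain ⟨Tm, hTm, hTm'⟩ := hasSum_mul_poleTerm_sub hm hone hZ
  obtain ⟨Ty, hTy, hTy'⟩ := hasSum_mul_poleTerm_sub hy1 hone hZ
  obtain ⟨Ap, hAp, hAp'⟩ := hasSum_mul_poleTerm_sub hp halt hZ'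
  obtain ⟨Am, hAm, hAm'⟩ := hasSum_mul_poleTerm_sub hm halt hZ'
  have hfrac : HasSum (fracTerm x y) (1 / 2 * (Tp + Tm) - Ty
      - Complex.sin (Real.pi * x) / (2 * Complex.sin (Real.pi * y)) * (Ap - Am)) := by
    refine ((((hTp.add hTm).mul_left (1 / 2)).sub hTy).sub ((hAp.sub hAm).mul_left
      (Complex.sin (Real.pi * x) / (2 * Complex.sin (Real.pi * y))))).congr_fun fun k => ?_
    rw [fracTerm]
    ring
  have hS := tendsto_nhds_unique (tendsto_sum_fracTerm hyZ
    (fun n hn h => hn (hnorm hp h)) fun n hn h => hn (hnorm hm h)) hfrac.tendsto_sum_nat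
  have hF := (hasSum_zagierF_of_notInt (x := x) hyZ).tsum_eq
  rw [tsum_mul_left, hS] at hF
  have hsin := sin_pi_mul_ne_zero_of_notInt hyZ
  have hpi : (Real.pi : ℂ) ≠ 0 := by exact_mod_cast Real.pi_ne_zero
  refine ⟨1 / 2 * (Tp + Tm) - Ty, 1 / 2 * (Ap - Am), ?_, ?_, ?_⟩
  · rw [← hF]
    generalize Complex.sin (Real.pi * y) = σ at hsin ⊢
    generalize Complex.sin (Real.pi * x) = τ
    field_simp
  · refine (((hTp'.add hTm').mul_left (1 / 2)).sub hTy').congr_fun fun m => ?_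
    ring
  · refine ((hAp'.sub hAm').mul_left (1 / 2)).congr_fun fun m => ?_
    ring

lemma norm_zetaSum_le (n : ℕ) : ‖zetaSum (n + 3)‖ ≤ ∑' k : ℕ, 1 / ((k : ℝ) + 1) ^ 3 := by
  refine tsum_of_norm_bounded (summable_zetaSum (s := 3) (by norm_num)).hasSum fun k => ?_
  rw [norm_div, norm_pow, norm_natCast_add_one, norm_one]
  gcongr
  · simp
  · lia

/-- Since binomial coefficients of `2n + 2` are at most `4 ^ (n + 1)`, such series converge in the
polydisc of radius `1 / 2`. -/
lemma summable_choose_mul {u v : ℂ} (hu : ‖u‖ < 1 / 2) (hv : ‖v‖ < 1 / 2) {κ : ℕ × ℕ → ℂ} {K : ℝ}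
    (hκ : ∀ q, ‖κ q‖ ≤ K) {c : ℕ × ℕ → ℕ} (hc : ∀ q, c q ≤ 2 ^ (2 * (q.1 + q.2) + 2)) (i j : ℕ) :
    Summable fun q : ℕ × ℕ => κ q * (2 * (c q : ℂ) * (u ^ (2 * q.1 + i) * v ^ (2 * q.2 + j))) := by
  have hgeo : ∀ {w : ℂ}, ‖w‖ < 1 / 2 → Summable fun n : ℕ => (4 * ‖w‖ ^ 2) ^ n := fun {w} hw =>
    summable_geometric_of_lt_one (by positivity) (by nlinarith [norm_nonneg w])
  have hK : 0 ≤ K := (norm_nonneg _).trans (hκ (0, 0))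
  refine (((hgeo hu).mul_of_nonneg (hgeo hv) (fun _ => by positivity)
    fun _ => by positivity).mul_left (K * 8 * ‖u‖ ^ i * ‖v‖ ^ j)).of_norm_bounded fun q => ?_
  have hc' : (c q : ℝ) ≤ 2 ^ (2 * (q.1 + q.2) + 2) := by exact_mod_cast hc q
  rw [norm_mul, norm_mul, norm_mul, norm_mul, norm_pow, norm_pow, Complex.norm_natCast,
    Complex.norm_ofNat]
  calc _ ≤ K * (2 * 2 ^ (2 * (q.1 + q.2) + 2) * (‖u‖ ^ (2 * q.1 + i) * ‖v‖ ^ (2 * q.2 + j))) := by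
        gcongr
        exact hκ q
    _ = _ := by
        rw [mul_pow, mul_pow, pow_add 2, pow_mul 2, pow_add, pow_add, pow_add, pow_mul, pow_mul]
        norm_num
        ring

/-- An absolutely convergent double series whose antidiagonal sums are known. -/
lemma HasSum.of_antidiagonal {f : ℕ × ℕ → ℂ} {g : ℕ → ℂ} {t : ℂ} (hf : Summable f)
    (hg : HasSum g t) (h : ∀ n, g n = ∑ q ∈ Finset.HasAntidiagonal.antidiagonal n, f q) :
    HasSum f t := by
  have h1 := hasSum_sum_antidiagonal hf.hasSum
  simp only [← h] at h1
  rw [hg.unique h1]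
  exact hf.hasSum

/-- Multiplication of a double series by a series in the second variable. -/
lemma hasSum_mul_antidiagonal_snd {f : ℕ × ℕ → ℂ} {g : ℕ → ℂ} {s t : ℂ} (hf : HasSum f s)
    (hg : HasSum g t) :
    HasSum (fun p : ℕ × ℕ => ∑ q ∈ Finset.HasAntidiagonal.antidiagonal p.2, f (p.1, q.1) * g q.2)
      (s * t) := by
  have h := hf.mul hg (summable_mul_of_summable_norm hf.summable.norm hg.summable.norm)
  exact hasSum_sum_antidiagonal_snd (f := fun p : ℕ × ℕ × ℕ => f (p.1, p.2.1) * g p.2.2)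
    ((Equiv.prodAssoc ℕ ℕ ℕ).symm.hasSum_iff.2 h)

/-- In `Ĥ(a, b)` the binomial coefficients vanish for small `r`; the remaining range is an
antidiagonal. -/
lemma sum_Icc_eq_sum_antidiagonal {f : ℕ → ℂ} {a : ℕ} (b : ℕ) (hf : ∀ r ≤ a, f r = 0) :
    ∑ r ∈ Finset.Icc 1 (a + b + 1), f r
      = ∑ q ∈ Finset.HasAntidiagonal.antidiagonal b, f (a + 1 + q.1) := by
  rw [Finset.Nat.sum_antidiagonal_eq_sum_range_succ_mk]
  have h := Finset.sum_Ico_eq_sum_range f (a + 1) (a + b + 2)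
  rw [show a + b + 2 - (a + 1) = b + 1 by lia] at h
  rw [Nat.succ_eq_add_one, ← h]
  refine (Finset.sum_subset (fun r hr => ?_) fun r hr hr' => ?_).symm
  · rw [Finset.mem_Ico] at hr
    rw [Finset.mem_Icc]
    lia
  · rw [Finset.mem_Icc] at hr
    rw [Finset.mem_Ico] at hr'
    exact hf r (by lia)

/-- The term of `F̂(x, y)` as a difference of two Cauchy product coefficients. -/
lemma pi_mul_genTerm_zagierHhat (x y : ℂ) (a b : ℕ) :
    Real.pi * genTerm zagierHhat x y (a, b)
      = ∑ q ∈ Finset.HasAntidiagonal.antidiagonal b,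
          zetaSum (2 * (a + q.1) + 3) * (2 * ((2 * (a + q.1) + 2).choose (2 * a + 2) : ℂ)
            * (x ^ (2 * a + 2) * y ^ (2 * q.1 + 0)))
            * ((-1) ^ q.2 * (mzv (twos q.2) : ℂ) * (Real.pi * y ^ (2 * q.2 + 1)))
        - ∑ q ∈ Finset.HasAntidiagonal.antidiagonal a,
          (1 - 2 / 2 ^ (2 * (b + q.1) + 3)) * zetaSum (2 * (b + q.1) + 3)
            * (2 * ((2 * (b + q.1) + 2).choose (2 * b + 1) : ℂ)
            * (y ^ (2 * b + 1) * x ^ (2 * q.1 + 1)))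
            * ((-1) ^ q.2 * (mzv (twos q.2) : ℂ) * (Real.pi * x ^ (2 * q.2 + 1))) := by
  let f : ℕ → ℂ := fun r => (-1) ^ (a + b + 1 + r) * ((2 * r).choose (2 * a + 2) : ℂ)
    * (zetaSum (2 * r + 1) * mzv (twos (a + b + 1 - r)))
    * (2 * Real.pi * x ^ (2 * a + 2) * y ^ (2 * b + 1))
  let g : ℕ → ℂ := fun r => (-1) ^ (a + b + 1 + r) * ((1 - 1 / 2 ^ (2 * r))
    * ((2 * r).choose (2 * b + 1) : ℂ)) * (zetaSum (2 * r + 1) * mzv (twos (a + b + 1 - r)))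
    * (2 * Real.pi * x ^ (2 * a + 2) * y ^ (2 * b + 1))
  have hL : Real.pi * genTerm zagierHhat x y (a, b)
      = ∑ r ∈ Finset.Icc 1 (a + b + 1), f r - ∑ r ∈ Finset.Icc 1 (a + b + 1), g r := by
    rw [← Finset.sum_sub_distrib, genTerm, zagierHhat]
    push_cast
    rw [Finset.mul_sum, Finset.mul_sum, Finset.sum_mul, Finset.sum_mul, Finset.mul_sum]
    refine Finset.sum_congr rfl fun r _ => ?_
    simp only [f, g, zagierCoeff, mzv_single]
    push_cast
    rw [pow_add _ _ r]
    ring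
  rw [hL, sum_Icc_eq_sum_antidiagonal b fun r hr => ?_, add_comm a b,
    sum_Icc_eq_sum_antidiagonal a fun r hr => ?_]
  · congr 1
    · refine Finset.sum_congr rfl fun q hq => ?_
      obtain ⟨d, s⟩ := q
      obtain rfl := Finset.HasAntidiagonal.mem_antidiagonal.1 hq
      simp only [f]
      rw [show a + (d + s) + 1 - (a + 1 + d) = s by lia,
        show a + (d + s) + 1 + (a + 1 + d) = 2 * (a + 1 + d) + s by ring, pow_add (-1 : ℂ),
        pow_mul (-1 : ℂ), neg_one_sq, one_pow,
        show 2 * (a + 1 + d) = 2 * (a + d) + 2 by ring]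
      ring
    · refine Finset.sum_congr rfl fun q hq => ?_
      obtain ⟨d, s⟩ := q
      obtain rfl := Finset.HasAntidiagonal.mem_antidiagonal.1 hq
      simp only [g]
      rw [show (d + s) + b + 1 - (b + 1 + d) = s by lia,
        show (d + s) + b + 1 + (b + 1 + d) = 2 * (b + 1 + d) + s by ring, pow_add (-1 : ℂ),
        pow_mul (-1 : ℂ), neg_one_sq, one_pow,
        show 2 * (b + 1 + d) = 2 * (b + d) + 2 by ring,
        show (2 : ℂ) / 2 ^ (2 * (b + d) + 3) = 1 / 2 ^ (2 * (b + d) + 2) by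
          rw [pow_succ _ (2 * (b + d) + 2)]; field_simp]
      ring
  · simp only [g]
    rw [Nat.choose_eq_zero_of_lt (by lia)]
    simp
  · simp only [f]
    rw [Nat.choose_eq_zero_of_lt (by lia)]
    simp

/-- Near the origin, `F̂` converges to `F`. -/
lemma hasSum_genTerm_zagierHhat {x y : ℂ} (hy0 : y ≠ 0) (hx : ‖x‖ < 1 / 2) (hy : ‖y‖ < 1 / 2) :
    HasSum (genTerm zagierHhat x y) (zagierF x y) := by
  obtain ⟨U, V, hF, hU, hV⟩ := exists_hasSum_zagierF hy0 hx hy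
  have hA : HasSum (fun q : ℕ × ℕ => zetaSum (2 * (q.1 + q.2) + 3)
      * (2 * ((2 * (q.1 + q.2) + 2).choose (2 * q.1 + 2) : ℂ)
      * (x ^ (2 * q.1 + 2) * y ^ (2 * q.2 + 0)))) U := by
    refine HasSum.of_antidiagonal (summable_choose_mul hx hy (fun q => norm_zetaSum_le _)
      (fun q => Nat.choose_le_two_pow _ _) 2 0) hU fun n => ?_
    rw [add_pow_add_sub_pow, Finset.mul_sum]
    refine Finset.sum_congr rfl fun q hq => ?_
    rw [Finset.HasAntidiagonal.mem_antidiagonal.1 hq, add_zero]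
  have hB : HasSum (fun q : ℕ × ℕ => (1 - 2 / 2 ^ (2 * (q.1 + q.2) + 3))
      * zetaSum (2 * (q.1 + q.2) + 3)
      * (2 * ((2 * (q.1 + q.2) + 2).choose (2 * q.1 + 1) : ℂ)
      * (y ^ (2 * q.1 + 1) * x ^ (2 * q.2 + 1)))) V := by
    have hone : ∀ n : ℕ, ‖(1 : ℂ) - 2 / 2 ^ (n + 3)‖ ≤ 2 := fun n => by
      refine (norm_sub_le _ _).trans ?_
      rw [norm_one, norm_div, norm_pow, Complex.norm_ofNat, pow_succ,
        div_mul_cancel_right₀ two_ne_zero]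
      have : ((2 : ℝ) ^ (n + 2))⁻¹ ≤ 1 := inv_le_one_of_one_le₀ (one_le_pow₀ one_le_two)
      linarith
    refine HasSum.of_antidiagonal (summable_choose_mul hy hx
      (K := 2 * ∑' k : ℕ, 1 / ((k : ℝ) + 1) ^ 3) (fun q => ?_)
      (fun q => Nat.choose_le_two_pow _ _) 1 1) hV fun n => ?_
    · rw [norm_mul]
      exact mul_le_mul (hone _) (norm_zetaSum_le _) (norm_nonneg _) zero_le_two
    · rw [add_pow_sub_sub_pow, Finset.mul_sum]
      refine Finset.sum_congr rfl fun q hq => ?_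
      rw [Finset.HasAntidiagonal.mem_antidiagonal.1 hq]
  have h1 := hasSum_mul_antidiagonal_snd hA (hasSum_mzv_twos y)
  have h2 := (Equiv.prodComm ℕ ℕ).hasSum_iff.2
    (hasSum_mul_antidiagonal_snd hB (hasSum_mzv_twos x))
  have h3 := h1.sub h2
  rw [mul_comm U, mul_comm V, ← hF] at h3
  have hpi : (Real.pi : ℂ) ≠ 0 := by exact_mod_cast Real.pi_ne_zero
  rw [← hasSum_mul_left_iff hpi]
  refine h3.congr_fun fun p => ?_
  exact pi_mul_genTerm_zagierHhat x y p.1 p.2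

/-! ### Comparison of coefficients -/

/-- A power series vanishing on an interval `(0, δ)` has constant term zero: let `t → 0⁺`. -/
lemma eq_zero_of_hasSum_pow_zero {δ : ℝ} (hδ : 0 < δ) {g : ℕ → ℂ}
    (h : ∀ t : ℝ, 0 < t → t < δ → HasSum (fun n => g n * (t : ℂ) ^ n) 0) : g 0 = 0 := by
  have hs := (h (δ / 2) (by linarith) (by linarith)).summable.norm
  have hlim : Tendsto (fun t : ℝ => ∑' n, g n * (t : ℂ) ^ n) (𝓝[>] 0)
      (𝓝 (∑' n, g n * ((0 : ℝ) : ℂ) ^ n)) := by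
    refine tendsto_tsum_of_dominated_convergence hs (fun n => ?_) ?_
    · exact (Continuous.tendsto (by fun_prop) 0).mono_left nhdsWithin_le_nhds
    · filter_upwards [Ioo_mem_nhdsGT (show (0 : ℝ) < δ / 2 by linarith)] with t ht n
      rw [norm_mul, norm_mul, norm_pow, norm_pow, Complex.norm_real, Complex.norm_real,
        Real.norm_of_nonneg ht.1.le, Real.norm_of_nonneg (by linarith : 0 ≤ δ / 2)]
      gcongr
      · exact ht.1.le
      · exact ht.2.le
  have hzero : Tendsto (fun t : ℝ => ∑' n, g n * (t : ℂ) ^ n) (𝓝[>] 0) (𝓝 0) := by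
    refine tendsto_const_nhds.congr' ?_
    filter_upwards [Ioo_mem_nhdsGT hδ] with t ht
    exact (h t ht.1 ht.2).tsum_eq.symm
  have := tendsto_nhds_unique hlim hzero
  rw [tsum_eq_single 0 fun n hn => by simp [hn]] at this
  simpa using this

lemma coeff_eq_zero_of_hasSum_pow_zero {δ : ℝ} (hδ : 0 < δ) {g : ℕ → ℂ}
    (h : ∀ t : ℝ, 0 < t → t < δ → HasSum (fun n => g n * (t : ℂ) ^ n) 0) (n : ℕ) : g n = 0 := by
  induction n generalizing g with
  | zero => exact eq_zero_of_hasSum_pow_zero hδ h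
  | succ n ih =>
    refine ih (g := fun n => g (n + 1)) fun t ht0 ht => ?_
    have h0 := eq_zero_of_hasSum_pow_zero hδ h
    have h1 := (hasSum_nat_add_iff' 1).2 (h t ht0 ht)
    rw [Finset.sum_range_one, h0, zero_mul, sub_zero] at h1
    have htc : (t : ℂ) ≠ 0 := by exact_mod_cast ht0.ne'
    rw [← hasSum_mul_right_iff htc, zero_mul]
    refine h1.congr_fun fun k => ?_
    ring

/-- Vanishing for small positive `s` and `t` suffices, comparing first the powers of `s`, then those
of `t`. -/
lemma coeff_eq_zero_of_hasSum_prod_pow_zero {δ : ℝ} (hδ : 0 < δ) {e : ℕ × ℕ → ℂ}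
    (h : ∀ s t : ℝ, 0 < s → s < δ → 0 < t → t < δ →
      HasSum (fun p : ℕ × ℕ => e p * (t : ℂ) ^ p.2 * (s : ℂ) ^ p.1) 0) (a b : ℕ) :
    e (a, b) = 0 := by
  have h1 : ∀ t : ℝ, 0 < t → t < δ → HasSum (fun b => e (a, b) * (t : ℂ) ^ b) 0 := by
    intro t ht0 ht
    have hsum : ∀ a, Summable fun b => e (a, b) * (t : ℂ) ^ b := by
      intro a
      have h8 := (h (δ / 2) t (by linarith) (by linarith) ht0 ht).summable.prod_factor a
      have hne : ((δ / 2 : ℝ) : ℂ) ^ a ≠ 0 :=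
        pow_ne_zero a (Complex.ofReal_ne_zero.2 (by linarith))
      exact (summable_mul_right_iff hne).1 h8
    have hfib : ∀ s : ℝ, ∀ a, HasSum (fun b => e (a, b) * (t : ℂ) ^ b * (s : ℂ) ^ a)
        ((∑' b, e (a, b) * (t : ℂ) ^ b) * (s : ℂ) ^ a) := fun s a =>
      (hsum a).hasSum.mul_right _
    have h0 : ∑' b, e (a, b) * (t : ℂ) ^ b = 0 :=
      coeff_eq_zero_of_hasSum_pow_zero hδ (g := fun a => ∑' b, e (a, b) * (t : ℂ) ^ b)
        (fun s hs0 hs => HasSum.prod_fiberwise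
          (f := fun p : ℕ × ℕ => e p * (t : ℂ) ^ p.2 * (s : ℂ) ^ p.1)
          (h s t hs0 hs ht0 ht) (hfib s)) a
    rw [← h0]
    exact (hsum a).hasSum
  exact coeff_eq_zero_of_hasSum_pow_zero hδ (g := fun b => e (a, b)) h1 b

/-- `F - F̂` vanishes near the origin off the axis `y = 0`; this is the same fact after division by
`x ^ 2 * y`, in the variables `s = x ^ 2` and `t = y ^ 2`. -/
lemma hasSum_zagierH_sub_zagierHhat {s t : ℝ} (hs0 : 0 < s) (hs : s < 1 / 4) (ht0 : 0 < t)
    (ht : t < 1 / 4) :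
    HasSum (fun p : ℕ × ℕ => (-1) ^ (p.1 + p.2 + 1) *
      ((zagierH p.1 p.2 : ℂ) - (zagierHhat p.1 p.2 : ℂ)) * (t : ℂ) ^ p.2 * (s : ℂ) ^ p.1) 0 := by
  obtain ⟨x, hx0, hx, hxs⟩ : ∃ x : ℂ, x ≠ 0 ∧ ‖x‖ < 1 / 2 ∧ x ^ 2 = s := by
    refine ⟨(√s : ℝ), Complex.ofReal_ne_zero.2 (Real.sqrt_pos.2 hs0).ne', ?_, ?_⟩
    · rw [Complex.norm_real, Real.norm_of_nonneg (Real.sqrt_nonneg s), Real.sqrt_lt' (by norm_num)]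
      linarith
    · rw [← Complex.ofReal_pow, Real.sq_sqrt hs0.le]
  obtain ⟨y, hy0, hy, hyt⟩ : ∃ y : ℂ, y ≠ 0 ∧ ‖y‖ < 1 / 2 ∧ y ^ 2 = t := by
    refine ⟨(√t : ℝ), Complex.ofReal_ne_zero.2 (Real.sqrt_pos.2 ht0).ne', ?_, ?_⟩
    · rw [Complex.norm_real, Real.norm_of_nonneg (Real.sqrt_nonneg t), Real.sqrt_lt' (by norm_num)]
      linarith
    · rw [← Complex.ofReal_pow, Real.sq_sqrt ht0.le]
  have hF : HasSum (genTerm zagierH x y) (zagierF x y) :=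
    (hasSum_genTerm_zagierH x y).summable.hasSum
  have h := hF.sub (hasSum_genTerm_zagierHhat hy0 hx hy)
  rw [sub_self] at h
  have hc : x ^ 2 * y ≠ 0 := mul_ne_zero (pow_ne_zero 2 hx0) hy0
  rw [← hasSum_mul_left_iff hc, mul_zero]
  refine h.congr_fun fun p => ?_
  rw [← hxs, ← hyt]
  simp only [genTerm]
  ring

/-- The evaluation `H(a, b) = Ĥ(a, b)`. -/
theorem zagierH_eq_zagierHhat (a b : ℕ) : zagierH a b = zagierHhat a b := by
  have h := coeff_eq_zero_of_hasSum_prod_pow_zero (δ := 1 / 4) (by norm_num)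
    (e := fun p => (-1) ^ (p.1 + p.2 + 1) * ((zagierH p.1 p.2 : ℂ) - (zagierHhat p.1 p.2 : ℂ)))
    (fun s t hs0 hs ht0 ht => hasSum_zagierH_sub_zagierHhat hs0 hs ht0 ht) a b
  have h' := (mul_eq_zero.1 h).resolve_left (pow_ne_zero _ (neg_ne_zero.2 one_ne_zero))
  exact Complex.ofReal_injective (sub_eq_zero.1 h')

/-- The evaluation formula for `ζ(2, …, 2, 3, 2, …, 2)` (with convergence of all the series in it),
the identity for the `z`-derivative of `₃F₂(x, -x, z; 1 + y, 1 - y; 1)` at `z = 0`,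
and the equality `F = F̂` of the two generating functions. -/
theorem mainTheorem1 :
    ((∀ n : ℕ, Summable (mzvTerm (twos n))) ∧
      (∀ r : ℕ, 1 ≤ r → Summable (mzvTerm (single (2 * r + 1)))) ∧
      ∀ a b : ℕ, Summable (mzvTerm (twosThreeTwos a b)) ∧
        mzv (twosThreeTwos a b) =
          2 * ∑ r ∈ Finset.Icc 1 (a + b + 1),
            (-1) ^ r * zagierCoeff a b r * mzv (single (2 * r + 1))
              * mzv (twos (a + b + 1 - r))) ∧
    (∀ x y : ℂ, (∀ n : ℤ, y ≠ n) → (∀ n : ℤ, n ≠ 0 → x + y ≠ n) → (∀ n : ℤ, n ≠ 0 → x - y ≠ n) →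
      (∀ᶠ z in 𝓝 (0 : ℂ), Summable (hyp32Term x (-x) z (1 + y) (1 - y) 1)) ∧
      HasDerivAt (fun z : ℂ => hyp32 x (-x) z (1 + y) (1 - y) 1) (zagierPsi x y) 0) ∧
    (∀ x y : ℂ, Summable (genTerm zagierH x y) ∧ Summable (genTerm zagierHhat x y) ∧
      zagierF x y = zagierFhat x y) := by
  refine ⟨⟨summable_mzvTerm_twos, fun r hr => summable_mzvTerm_single (by lia), fun a b =>
    ⟨summable_mzvTerm_twosThreeTwos a b, zagierH_eq_zagierHhat a b⟩⟩, fun x y hy hp hm => ⟨?_, ?_⟩,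
    fun x y => ?_⟩
  · filter_upwards [Metric.closedBall_mem_nhds (0 : ℂ) one_pos] with z hz
    exact summable_hyp32Term hy (mem_closedBall_zero_iff.1 hz)
  · rw [← tsum_derivTerm_eq_zagierPsi hy hp hm]
    exact (hasDerivAt_hyp32 hy).2
  · have hH : zagierHhat = zagierH := (funext₂ zagierH_eq_zagierHhat).symm
    have hs := (hasSum_genTerm_zagierH x y).summable
    rw [zagierFhat, zagierF, hH]
    exact ⟨hs, hs, rfl⟩
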